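/- Let $S$ be a closed connected oriented surface, $V\subset S$ a finite nonempty set, and let $\Delta$ be a triangulation of $S$ with vertex set $V$, edge set $E$ and set of triangles $T$ (loops, multiple edges and triangles glued to themselves are allowed). Let $\lambda\in\mathbb{R}^{E}$ and put $\ell_e=e^{\lambda_e/2}$ for $e\in E$. Let $(\Delta,\lambda)$ be Penner coordinates: they describe the complete finite area hyperbolic surface with cusps $V$, decorated with a horocycle at each cusp and ideally triangulated by $\Delta$, for which $\lambda_e$ is the signed distance of the horocycles at the two ends of (a lift of) the edge $e$. An ideal cell decomposition of a decorated surface is called *ideal Delaunay* if, after replacing all horocycles by horocycles at an equal distance closer to the cusps (distance $0$ allowed) so that they bound disjoint cusp neighborhoods, for every face of the lifted decomposition of $H^2$ there is a circle that touches all lifted horocycles centered at the vertices of this face externally and does not meet any other lifted horocycle. The triangulation $\Delta$ is an *ideal Delaunay triangulation* if it refines an ideal Delaunay decomposition, that is, if the edge set of the latter is a subset of $E$. If $\ell$ satisfies the strict triangle inequalities $\ell_{e_1}<\ell_{e_2}+\ell_{e_3}$, $\ell_{e_2}<\ell_{e_3}+\ell_{e_1}$, $\ell_{e_3}<\ell_{e_1}+\ell_{e_2}$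 for the sides $e_1,e_2,e_3$ of every triangle of $T$, let $(\Delta,\ell)$ be the surface $S$ with the piecewise euclidean metric that turns each triangle into a euclidean triangle and each edge $e$ into a line segment of length $\ell_e$. The triangulation $\Delta$ is a *Delaunay triangulation* of $(\Delta,\ell)$ if the circumdisk of every triangle is an immersed empty disk, that is, if unfolding the surface from this triangle over its open circumdisk one never meets a vertex in the open circumdisk. (i) If $\Delta$ is an ideal Delaunay triangulation of the decorated hyperbolic surface with Penner coordinates $(\Delta,\lambda)$, then $\ell$ satisfies the strict triangle inequalities for every triangle, and $\Delta$ is a Delaunay triangulation of the piecewise euclidean surface $(\Delta,\ell)$. (ii) Conversely, if $\ell$ satisfies the strict triangle inequalities for every triangle and $\Delta$ is a Delaunay triangulation of the piecewise euclidean surface $(\Delta,\ell)$, then $\Delta$ is an ideal Delaunay triangulation of the decorated hyperbolic surface with Penner coordinates $(\Delta,\lambda)$. -/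

import Mathlib

/-! ## Triangulated closed oriented surfaces -/

/-- A triangulation of a closed connected oriented surface `S` with vertex set `V` (loops, multiple
edges and self-glued triangles are allowed), given by its set `T` of triangles and the gluing of
their sides. Every triangle has corners `0, 1, 2` in positive cyclic order, and the side `(t, i)`
is the side of `t` opposite to corner `i`; it joins the corners `i + 1` and `i + 2`. If
`glue (t, i) = (t', j)`, then these two sides are identified so that corner `i + 1` of `t` matches
corner `j + 2` of `t'` and corner `i + 2` of `t` matches corner `j + 1` of `t'`. -/
structure Triangulation (T : Type*) where
  glue : T × Fin 3 → T × Fin 3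
  glue_glue : ∀ d, glue (glue d) = d
  glue_ne : ∀ d, glue d ≠ d
  connected : ∀ t t' : T,
    Relation.ReflTransGen (fun a b => ∃ i, (glue (a, i)).1 = b) t t'

namespace Triangulation

variable {T : Type*} (Δ : Triangulation T)

/-- The edges of the triangulation: sides of triangles up to gluing. -/
def Edge : Type _ := Quot (fun d d' : T × Fin 3 => Δ.glue d = d')

/-- The edge of the triangulation on which side `i` of the triangle `t` lies. -/
def edge (t : T) (i : Fin 3) : Δ.Edge := Quot.mk _ (t, i)

variable {Δ}

/-- `ℓ = exp (λ / 2)`. -/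
noncomputable def ell (lam : Δ.Edge → ℝ) : Δ.Edge → ℝ := fun e => Real.exp (lam e / 2)

/-- The strict triangle inequalities for every triangle. -/
def TriangleInequalities (ℓ : Δ.Edge → ℝ) : Prop :=
  ∀ (t : T) (i : Fin 3),
    ℓ (Δ.edge t i) < ℓ (Δ.edge t (i + 1)) + ℓ (Δ.edge t (i + 2))

end Triangulation

/-! ## Horocycles in the hyperbolic plane -/

namespace Hyp

/-- The determinant of two vectors of `ℝ²`. -/
def det (v w : ℝ × ℝ) : ℝ := v.1 * w.2 - v.2 * w.1

/-- A nonzero vector `v = (a, b)` of `ℝ²` encodes a horocycle of the upper half plane `ℍ`: if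
`b ≠ 0`, the euclidean circle of diameter `1 / b ^ 2` touching the real line at `a / b`, and if
`b = 0`, the horizontal line at height `a ^ 2`. Each horocycle is encoded by exactly two vectors,
`v` and `-v`. The signed distance of the horocycles encoded by `v` and `w` (negative if they
intersect) is `λ = 2 * log |det v w|`, that is `|det v w| = exp (λ / 2)`.

`signedDist v z` is the signed hyperbolic distance of the point `z` from the horocycle encoded by
`v`, negative inside the horodisk. -/
noncomputable def signedDist (v : ℝ × ℝ) (z : UpperHalfPlane) : ℝ :=
  Real.log (Complex.normSq ((v.2 : ℂ) * (z : ℂ) - (v.1 : ℂ)) / z.im)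

/-- The horocycle encoded by `v`, moved by the distance `s` towards its center. -/
def horocycle (v : ℝ × ℝ) (s : ℝ) : Set UpperHalfPlane := {z | signedDist v z = -s}

/-- The open horodisk bounded by `horocycle v s`. -/
def horodisk (v : ℝ × ℝ) (s : ℝ) : Set UpperHalfPlane := {z | signedDist v z < -s}

/-- The hyperbolic circle with center `c` and radius `r` touches `horocycle v s` externally: the
closed disk and the closed horodisk have exactly one point in common. -/
def TouchesExternally (c : UpperHalfPlane) (r : ℝ) (v : ℝ × ℝ) (s : ℝ) : Prop :=
  ∃ p, Metric.closedBall c r ∩ (horodisk v s ∪ horocycle v s) = {p}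

end Hyp

namespace Triangulation

variable {T : Type*} {Δ : Triangulation T}

/-! ## The decorated hyperbolic surface with Penner coordinates `(Δ, λ)`

The surface is glued from decorated ideal triangles. Its universal cover is the hyperbolic plane,
tiled by the lifts of these triangles. The lifts are obtained from one decorated ideal triangle in
the plane by repeatedly attaching the neighboring triangles (developing). -/

/-- A triangle `tri` of `Δ` placed in the hyperbolic plane as a positively oriented ideal triangle
decorated with horocycles (`vec i` encodes the horocycle at corner `i`) whose signed distances
along the sides are the given `λ`. -/
structure IdealTriangle (lam : Δ.Edge → ℝ) where
  tri : T
  vec : Fin 3 → ℝ × ℝ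
  det_eq : ∀ i, Hyp.det (vec (i + 1)) (vec (i + 2)) = ell lam (Δ.edge tri i)

/-- `τ` is the neighbor of `σ` across the side `i` of `σ`: its underlying triangle is the one glued
to this side, and `σ` and `τ` have the decorated side in common, on whose two different sides they
lie. (The sign keeps both determinants positive; it does not affect the horocycle.) -/
def IdealTriangle.Adj {lam : Δ.Edge → ℝ} (σ : IdealTriangle lam) (i : Fin 3)
    (τ : IdealTriangle lam) : Prop :=
  ∃ j, Δ.glue (σ.tri, i) = (τ.tri, j) ∧
    τ.vec (j + 1) = σ.vec (i + 2) ∧ τ.vec (j + 2) = -σ.vec (i + 1)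

/-- `σ` is one of the triangles of the lifted triangulation, the lift being fixed by the position
`σ₀` of one of its triangles. -/
def IsLift {lam : Δ.Edge → ℝ} (σ₀ σ : IdealTriangle lam) : Prop :=
  Relation.ReflTransGen (fun a b => ∃ i, a.Adj i b) σ₀ σ

/-- The lifted horocycles, moved by the distance `s` towards their centers. -/
def liftedHorocycles {lam : Δ.Edge → ℝ} (σ₀ : IdealTriangle lam) (s : ℝ) :
    Set (Set UpperHalfPlane) :=
  {h | ∃ σ k, IsLift σ₀ σ ∧ h = Hyp.horocycle (σ.vec k) s}

/-- The horocycles, moved by the distance `s` towards the cusps, bound disjoint cusp neighborhoods: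
the horodisks of different lifted horocycles are disjoint. -/
def DisjointCuspNeighborhoods {lam : Δ.Edge → ℝ} (σ₀ : IdealTriangle lam) (s : ℝ) : Prop :=
  ∀ σ k σ' k', IsLift σ₀ σ → IsLift σ₀ σ' →
    Hyp.horocycle (σ.vec k) s ≠ Hyp.horocycle (σ'.vec k') s →
    Disjoint (Hyp.horodisk (σ.vec k) s) (Hyp.horodisk (σ'.vec k') s)

/-- For a set `D` of edges of `Δ`, consider the decomposition of the surface obtained from `Δ` by
erasing the edges not in `D`. The triangle `τ` lies in the same face of its lift as `σ`. -/
def SameFace {lam : Δ.Edge → ℝ} (D : Set Δ.Edge) (σ τ : IdealTriangle lam) : Prop :=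
  Relation.ReflTransGen (fun a b => ∃ i, Δ.edge a.tri i ∉ D ∧ a.Adj i b) σ τ

/-- The (moved) lifted horocycles centered at the vertices of the lifted face that contains `σ`. -/
def faceHorocycles {lam : Δ.Edge → ℝ} (D : Set Δ.Edge) (σ : IdealTriangle lam) (s : ℝ) :
    Set (Set UpperHalfPlane) :=
  {h | ∃ τ k, SameFace D σ τ ∧ h = Hyp.horocycle (τ.vec k) s}

/-- The global Delaunay condition for the decomposition with edge set `D` and the horocycles moved
by the distance `s` towards the cusps: for every lifted face there is a circle that touches all
lifted horocycles centered at the vertices of the face externally and does not meet any other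
lifted horocycle. -/
def GlobalDelaunay {lam : Δ.Edge → ℝ} (σ₀ : IdealTriangle lam) (D : Set Δ.Edge) (s : ℝ) : Prop :=
  ∀ σ, IsLift σ₀ σ → ∃ (c : UpperHalfPlane) (r : ℝ), 0 < r ∧
    (∀ τ k, SameFace D σ τ → Hyp.TouchesExternally c r (τ.vec k) s) ∧
    (∀ h ∈ liftedHorocycles σ₀ s, h ∉ faceHorocycles D σ s → Disjoint (Metric.sphere c r) h)

/-- The decomposition with edge set `D ⊆ E_Δ` is the ideal Delaunay decomposition of the decorated
surface with Penner coordinates `(Δ, λ)`: the global Delaunay condition holds after replacing the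
horocycles by horocycles at equal distance `s ≥ 0` that bound disjoint cusp neighborhoods. (A circle
touches only finitely many disjoint horodisks, so the global condition forces the lifted faces to be
ideal polygons. The choices of `σ₀` and of the admissible `s` do not matter.) -/
def IsIdealDelaunayDecomposition (lam : Δ.Edge → ℝ) (D : Set Δ.Edge) : Prop :=
  ∃ (σ₀ : IdealTriangle lam) (s : ℝ), 0 ≤ s ∧
    DisjointCuspNeighborhoods σ₀ s ∧ GlobalDelaunay σ₀ D s

/-- `Δ` is an ideal Delaunay triangulation of the decorated surface with Penner coordinates
`(Δ, λ)`: it refines the ideal Delaunay decomposition. -/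
def IsIdealDelaunay (lam : Δ.Edge → ℝ) : Prop :=
  ∃ D : Set Δ.Edge, IsIdealDelaunayDecomposition lam D

/-! ## The piecewise euclidean surface `(Δ, ℓ)` -/

/-- A triangle `tri` of `Δ` placed in the euclidean plane as a positively oriented triangle with
side lengths `ℓ`. -/
structure EuclideanTriangle (ℓ : Δ.Edge → ℝ) where
  tri : T
  pt : Fin 3 → ℂ
  dist_eq : ∀ i, dist (pt (i + 1)) (pt (i + 2)) = ℓ (Δ.edge tri i)
  oriented : 0 < ((starRingEnd ℂ) (pt 1 - pt 0) * (pt 2 - pt 0)).im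

/-- `τ` is the triangle glued to the side `i` of `σ`, unfolded into the plane of `σ`. -/
def EuclideanTriangle.Adj {ℓ : Δ.Edge → ℝ} (σ : EuclideanTriangle ℓ) (i : Fin 3)
    (τ : EuclideanTriangle ℓ) : Prop :=
  ∃ j, Δ.glue (σ.tri, i) = (τ.tri, j) ∧
    τ.pt (j + 1) = σ.pt (i + 2) ∧ τ.pt (j + 2) = σ.pt (i + 1)

/-- `τ` is reached from `σ` by unfolding the surface over the open disk with center `c` and radius
`r`, that is, by successively unfolding triangles across sides that meet this disk. -/
def UnfoldsOver {ℓ : Δ.Edge → ℝ} (c : ℂ) (r : ℝ) (σ τ : EuclideanTriangle ℓ) : Prop :=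
  Relation.ReflTransGen
    (fun a b => ∃ i, (segment ℝ (a.pt (i + 1)) (a.pt (i + 2)) ∩ Metric.ball c r).Nonempty ∧
      a.Adj i b) σ τ

/-- The circumdisk of `σ` is an immersed empty disk of the piecewise euclidean surface: unfolding
the surface over the open circumdisk, one never meets a vertex in it. (Then the unfolding maps the
open circumdisk by a local isometry to the surface without its vertices, extending the inclusion of
the triangle. If instead one meets a vertex, there is no such map.) -/
def EmptyCircumdisk {ℓ : Δ.Edge → ℝ} (σ : EuclideanTriangle ℓ) : Prop :=
  ∃ (c : ℂ) (r : ℝ), (∀ k, dist (σ.pt k) c = r) ∧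
    ∀ τ k, UnfoldsOver c r σ τ → τ.pt k ∉ Metric.ball c r

/-- `Δ` is a Delaunay triangulation of the piecewise euclidean surface `(Δ, ℓ)`: the circumdisk of
every triangle is an immersed empty disk. -/
def IsEuclideanDelaunay (ℓ : Δ.Edge → ℝ) : Prop :=
  ∀ t : T, ∃ σ : EuclideanTriangle ℓ, σ.tri = t ∧ EmptyCircumdisk σ

end Triangulation

/-! ## Distances to horocycles -/

namespace Hyp

open UpperHalfPlane

/-! Both Delaunay properties are compared with one local condition, `LocallyDelaunay`: at every edge
the two opposite angles, computed from the lengths by the law of cosines, have nonnegative cosine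
sum.

Hyperbolic side. A point `z` of `ℍ` is a positive definite quadratic form `horoForm z` of
determinant one on `ℝ²`, and the signed distance of `z` from the horocycle of `v` is the logarithm
of its value at `v`. Hence the center of a circle touching the three horocycles of a triangle is a
form constant on the three vectors, that is, a multiple of `circumForm`, the form with value `1`
there. Such a center exists because `circumForm` is positive definite, which amounts to the triangle
inequalities. The forms of two neighbors agree on the common side, so they differ by the cosine sum
times a product of two determinants (`AdjAt.circumForm_sub`). Evaluation at the neighbor's apex
turns the global condition into the local one. Conversely, along a path that never turns back the
forms decrease on vectors lying ahead, so `circumForm` is at least `1` on all lifted vectors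
(`one_le_circumForm`). Equality occurs only on the face obtained by erasing the edges with cosine
sum zero. Finiteness of `T` bounds the nonzero determinants of lifted vectors from below
(`le_abs_det`), so the horodisks become disjoint after a shift.

Euclidean side. The power of a point with respect to the circumcircle replaces `circumForm`. Its
value at the neighbor's apex has the sign of the cosine sum (`AdjAt.power_nonneg_iff`), and a second
induction over reduced paths (`mem_ball_of_reducedPath`) passes from the local to the empty disk
condition. -/

theorem signedDist_smul (g : Matrix.SpecialLinearGroup (Fin 2) ℝ) (w : ℝ × ℝ) (z : ℍ) :
    signedDist (g 0 0 * w.1 + g 0 1 * w.2, g 1 0 * w.1 + g 1 1 * w.2) (g • z) =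
      signedDist w z := by
  have hd : (g 0 0 : ℂ) * g 1 1 - g 0 1 * g 1 0 = 1 := by
    have := g.det_coe
    rw [Matrix.det_fin_two] at this
    exact_mod_cast this
  have hc : ((g • z : ℍ) : ℂ) =
      ((g 0 0 : ℂ) * z + g 0 1) / ((g 1 0 : ℂ) * z + g 1 1) := by
    simpa using coe_specialLinearGroup_apply g z
  have hD : (g 1 0 : ℂ) * z + g 1 1 ≠ 0 := by
    intro h
    have h1 : z.im ≠ 0 := z.im_pos.ne'
    have h2 := congrArg Complex.im h
    have h3 := congrArg Complex.re h
    simp [h1] at h2 h3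
    simp [h2] at h3
    simp [h2, h3] at hd
  have him : (g • z).im = z.im / Complex.normSq ((g 1 0 : ℂ) * z + g 1 1) := by
    have : (g • z).im = (((g 0 0 : ℂ) * z + g 0 1) / ((g 1 0 : ℂ) * z + g 1 1)).im := by
      rw [← hc]; rfl
    rw [this, Complex.div_im, ← sub_div]
    congr 1
    have hd' : g 0 0 * g 1 1 - g 0 1 * g 1 0 = 1 := by exact_mod_cast hd
    simp
    linear_combination z.im * hd'
  unfold signedDist
  rw [him, hc]
  have : (((g 1 0 * w.1 + g 1 1 * w.2 : ℝ) : ℂ)) *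
      (((g 0 0 : ℂ) * z + g 0 1) / ((g 1 0 : ℂ) * z + g 1 1)) -
        ((g 0 0 * w.1 + g 0 1 * w.2 : ℝ) : ℂ) =
      ((w.2 : ℂ) * z - w.1) / ((g 1 0 : ℂ) * z + g 1 1) := by
    rw [eq_div_iff hD, sub_mul, mul_assoc, div_mul_cancel₀ _ hD]
    push_cast
    linear_combination ((w.2 : ℂ) * z - w.1) * hd
  simp only [this]
  rw [Complex.normSq_div, div_div_div_cancel_right₀ (Complex.normSq_pos.2 hD).ne']

theorem signedDist_one_zero (z : ℍ) : signedDist (1, 0) z = -Real.log z.im := by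
  simp [signedDist]

theorem exists_specialLinearGroup_apply_eq {v : ℝ × ℝ} (hv : v ≠ 0) :
    ∃ g : Matrix.SpecialLinearGroup (Fin 2) ℝ,
      (g 0 0 * v.1 + g 0 1 * v.2, g 1 0 * v.1 + g 1 1 * v.2) = ((1, 0) : ℝ × ℝ) := by
  obtain ⟨a, b⟩ := v
  have hn : a ^ 2 + b ^ 2 ≠ 0 := by
    intro h
    apply hv
    have ha : a = 0 := by nlinarith [sq_nonneg a, sq_nonneg b]
    have hb : b = 0 := by nlinarith [sq_nonneg a, sq_nonneg b]
    simp [ha, hb]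
  refine ⟨⟨!![a / (a ^ 2 + b ^ 2), b / (a ^ 2 + b ^ 2); -b, a], by
      rw [Matrix.det_fin_two_of]; field_simp; ring⟩, ?_⟩
  ext
  · simp
    field_simp
  · simp
    ring

/-- In a suitable isometric coordinate the horocycle encoded by `v` is the line at height `1`. -/
theorem exists_isometryEquiv_signedDist {v : ℝ × ℝ} (hv : v ≠ 0) :
    ∃ φ : ℍ ≃ᵢ ℍ, ∀ z, signedDist v z = -Real.log (φ z).im := by
  obtain ⟨g, hg⟩ := exists_specialLinearGroup_apply_eq hv
  refine ⟨IsometryEquiv.constSMul g, fun z => ?_⟩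
  rw [IsometryEquiv.constSMul_apply, ← signedDist_one_zero, ← hg, signedDist_smul]

theorem abs_signedDist_sub_le {v : ℝ × ℝ} (hv : v ≠ 0) (z w : ℍ) :
    |signedDist v z - signedDist v w| ≤ dist z w := by
  obtain ⟨φ, hφ⟩ := exists_isometryEquiv_signedDist hv
  rw [hφ, hφ, ← φ.dist_eq z w, neg_sub_neg, abs_sub_comm]
  exact dist_log_im_le _ _

/-- Moving along the geodesic through `z` that ends at the center of the horocycle changes the
signed distance at unit speed. -/
theorem exists_dist_eq_abs_signedDist_eq {v : ℝ × ℝ} (hv : v ≠ 0) (z : ℍ) (t : ℝ) :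
    ∃ w, dist w z = |t| ∧ signedDist v w = signedDist v z - t := by
  obtain ⟨φ, hφ⟩ := exists_isometryEquiv_signedDist hv
  have hp : 0 < (φ z).im * Real.exp t := mul_pos (φ z).im_pos (Real.exp_pos t)
  let p : ℍ := ⟨⟨(φ z).re, (φ z).im * Real.exp t⟩, hp⟩
  have hl : Real.log p.im = Real.log (φ z).im + t := by
    change Real.log ((φ z).im * Real.exp t) = _
    rw [Real.log_mul (φ z).im_pos.ne' (Real.exp_pos t).ne', Real.log_exp]
  refine ⟨φ.symm p, ?_, ?_⟩
  · rw [← φ.dist_eq, φ.apply_symm_apply,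
      dist_of_re_eq (z := p) (w := φ z) rfl, Real.dist_eq, hl]
    simp
  · rw [hφ, hφ, φ.apply_symm_apply, hl]; ring

theorem exists_mem_sphere_signedDist_eq {v : ℝ × ℝ} (hv : v ≠ 0) (z : ℍ) {r u : ℝ}
    (h : |signedDist v z - u| ≤ r) : ∃ w, dist w z = r ∧ signedDist v w = u := by
  obtain ⟨φ, hφ⟩ := exists_isometryEquiv_signedDist hv
  have hr : 0 ≤ r := (abs_nonneg _).trans h
  set y := (φ z).im with hy
  have hy0 : 0 < y := (φ z).im_pos
  set Y := Real.exp (-u) with hY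
  have hY0 : 0 < Y := Real.exp_pos _
  have hc : Real.cosh (Real.log (Y / y)) ≤ Real.cosh r := by
    rw [Real.cosh_le_cosh, abs_of_nonneg hr, Real.log_div hY0.ne' hy0.ne', hY, Real.log_exp]
    rw [hφ] at h
    convert h using 2
    ring
  rw [Real.cosh_log (by positivity)] at hc
  have hx : 0 ≤ 2 * Y * y * (Real.cosh r - 1) - (Y - y) ^ 2 := by
    have : (Y / y + (Y / y)⁻¹) / 2 = (Y ^ 2 + y ^ 2) / (2 * Y * y) := by field_simp
    rw [this, div_le_iff₀ (by positivity)] at hc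
    nlinarith
  -- The horizontal offset at height `Y` is solved from the formula for `cosh (dist p (φ z))`; `hx`
  -- makes the root real.
  let p : ℍ := ⟨⟨(φ z).re + √(2 * Y * y * (Real.cosh r - 1) - (Y - y) ^ 2), Y⟩, hY0⟩
  have hpi : p.im = Y := rfl
  refine ⟨φ.symm p, ?_, ?_⟩
  · rw [← φ.dist_eq, φ.apply_symm_apply]
    apply Real.cosh_injOn (Set.mem_Ici.2 dist_nonneg) (Set.mem_Ici.2 hr)
    rw [cosh_dist, Complex.dist_eq, ← Complex.normSq_eq_norm_sq, Complex.normSq_apply]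
    have h1 : ((p : ℂ) - (φ z : ℂ)).re = √(2 * Y * y * (Real.cosh r - 1) - (Y - y) ^ 2) := by
      simp [p]
    have h2 : ((p : ℂ) - (φ z : ℂ)).im = Y - y := by
      simp [p, hy]
    rw [h1, h2, Real.mul_self_sqrt hx, hpi, ← hy]
    field_simp
    ring
  · rw [hφ, φ.apply_symm_apply, hpi, hY, Real.log_exp, neg_neg]

/-- With the center of the horocycle at infinity, a displacement of length at most `t` can raise
`log im` by `t` only if it is vertical, so the nearest point is unique. -/
theorem eq_of_dist_le_of_signedDist_le {v : ℝ × ℝ} (hv : v ≠ 0) {z p q : ℍ} {t : ℝ}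
    (hp : dist p z ≤ t) (hp' : signedDist v p ≤ signedDist v z - t)
    (hq : dist q z ≤ t) (hq' : signedDist v q ≤ signedDist v z - t) : p = q := by
  obtain ⟨φ, hφ⟩ := exists_isometryEquiv_signedDist hv
  have key : ∀ {p : ℍ}, dist p z ≤ t → signedDist v p ≤ signedDist v z - t →
      (φ p : ℂ) = ⟨(φ z).re, (φ z).im * Real.exp t⟩ := by
    intro p hp hp'
    have h1 := dist_log_im_le (φ p) (φ z)
    rw [φ.dist_eq, Real.dist_eq] at h1
    rw [hφ, hφ] at hp'
    have h2 : Real.log (φ p).im = Real.log (φ z).im + t := by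
      have := le_abs_self (Real.log (φ p).im - Real.log (φ z).im)
      linarith
    have h3 : (φ p).im = (φ z).im * Real.exp t := by
      rw [← Real.exp_log (φ p).im_pos, h2, Real.exp_add, Real.exp_log (φ z).im_pos]
    have h4 : Real.cosh (dist (φ p) (φ z)) ≤ Real.cosh t := by
      rw [Real.cosh_le_cosh, abs_of_nonneg dist_nonneg, φ.dist_eq]
      exact hp.trans (le_abs_self t)
    rw [cosh_dist, Complex.dist_eq, ← Complex.normSq_eq_norm_sq, Complex.normSq_apply,
      Real.cosh_eq, Real.exp_neg, Complex.sub_re, Complex.sub_im] at h4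
    simp only [coe_re, coe_im] at h4
    rw [h3] at h4
    have hy := (φ z).im_pos
    have hE := Real.exp_pos t
    set E := Real.exp t
    set y := (φ z).im
    set x := (φ p).re - (φ z).re with hx
    have h5 : x ^ 2 = 0 := by
      have h6 : 1 + (x * x + (y * E - y) * (y * E - y)) / (2 * (y * E) * y) =
          (E + E⁻¹) / 2 + x ^ 2 / (2 * (y * E) * y) := by
        field_simp; ring
      rw [h6] at h4
      have h7 : x ^ 2 / (2 * (y * E) * y) ≤ 0 := by linarith
      have h8 : 0 < 2 * (y * E) * y := by positivity
      rw [div_le_iff₀ h8] at h7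
      nlinarith [sq_nonneg x]
    apply Complex.ext
    · have := pow_eq_zero_iff (two_ne_zero) |>.1 h5
      change (φ p).re = (φ z).re
      linarith
    · exact h3
  apply φ.injective
  exact UpperHalfPlane.ext ((key hp hp').trans (key hq hq').symm)

theorem TouchesExternally.signedDist_eq {c : ℍ} {r : ℝ} {v : ℝ × ℝ} {s : ℝ} (hv : v ≠ 0)
    (hr : 0 < r) (h : TouchesExternally c r v s) : signedDist v c = r - s := by
  obtain ⟨p, hp⟩ := h
  have hmem : ∀ q, q ∈ Metric.closedBall c r ∩ (horodisk v s ∪ horocycle v s) ↔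
      dist q c ≤ r ∧ signedDist v q ≤ -s := by
    intro q
    rw [Set.mem_inter_iff, Metric.mem_closedBall, le_iff_lt_or_eq (a := signedDist v q)]
    rfl
  have hpm : dist p c ≤ r ∧ signedDist v p ≤ -s := (hmem p).1 (hp ▸ rfl)
  have huniq : ∀ q, dist q c ≤ r → signedDist v q ≤ -s → q = p := fun q h1 h2 => by
    have := (hmem q).2 ⟨h1, h2⟩
    rwa [hp] at this
  have h1 := le_abs_self (signedDist v c - signedDist v p)
  have h2 := abs_signedDist_sub_le hv c p
  rw [dist_comm] at h2
  refine le_antisymm (by linarith [hpm.1, hpm.2]) (not_lt.1 fun hlt => ?_)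
  -- If the center were too close, its perpendicular to the horocycle would give two common points,
  -- at distances `t < r` and `r`. The maximum with `0` covers a center already inside the horodisk.
  set t := max 0 (signedDist v c + s) with ht
  have ht0 : 0 ≤ t := le_max_left _ _
  have htr : t < r := max_lt hr (by linarith)
  have hts : signedDist v c + s ≤ t := le_max_right _ _
  obtain ⟨q, hq1, hq2⟩ := exists_dist_eq_abs_signedDist_eq hv c t
  obtain ⟨q', hq1', hq2'⟩ := exists_dist_eq_abs_signedDist_eq hv c r
  rw [abs_of_nonneg ht0] at hq1
  rw [abs_of_pos hr] at hq1'
  have e1 := huniq q (by linarith) (by linarith)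
  have e2 := huniq q' (by linarith) (by linarith)
  rw [e1] at hq1
  rw [e2] at hq1'
  linarith

theorem touchesExternally_of_signedDist_eq {c : ℍ} {r : ℝ} {v : ℝ × ℝ} {s : ℝ} (hv : v ≠ 0)
    (hr : 0 ≤ r) (h : signedDist v c = r - s) : TouchesExternally c r v s := by
  obtain ⟨p, hp1, hp2⟩ := exists_dist_eq_abs_signedDist_eq hv c r
  rw [abs_of_nonneg hr] at hp1
  have hps : signedDist v p = -s := by linarith
  refine ⟨p, Set.eq_singleton_iff_unique_mem.2
    ⟨⟨Metric.mem_closedBall.2 hp1.le, Or.inr hps⟩, ?_⟩⟩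
  rintro q ⟨hq1, hq2⟩
  have hq2' : signedDist v q ≤ -s := by
    rcases hq2 with h | h
    · exact le_of_lt h
    · exact le_of_eq h
  exact eq_of_dist_le_of_signedDist_le hv (t := r) hq1 (by linarith) hp1.le
    (by linarith)

theorem disjoint_sphere_horocycle {c : ℍ} {r : ℝ} {v : ℝ × ℝ} {s : ℝ} (hv : v ≠ 0)
    (h : r - s < signedDist v c) : Disjoint (Metric.sphere c r) (horocycle v s) := by
  rw [Set.disjoint_left]
  intro z hz hz'
  have h1 : signedDist v z = -s := hz'
  have h2 := abs_signedDist_sub_le hv c z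
  rw [dist_comm, Metric.mem_sphere.1 hz] at h2
  linarith [le_abs_self (signedDist v c - signedDist v z)]

/-- The second alternative is a circle lying inside the horodisk; disjointness of horodisks excludes
it later. -/
theorem signedDist_of_disjoint_sphere {c : ℍ} {r : ℝ} {v : ℝ × ℝ} {s : ℝ} (hv : v ≠ 0)
    (h : Disjoint (Metric.sphere c r) (horocycle v s)) :
    r - s < signedDist v c ∨ signedDist v c < -r - s := by
  by_contra! hc
  obtain ⟨w, hw1, hw2⟩ := exists_mem_sphere_signedDist_eq hv c (r := r) (u := -s)
    (abs_le.2 ⟨by linarith, by linarith⟩)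
  exact Set.disjoint_left.1 h (Metric.mem_sphere.2 hw1) hw2

/-- A circle touching one of two disjoint horodisks externally is not contained in the other. -/
theorem le_signedDist_of_disjoint_horodisk {c : ℍ} {r : ℝ} {v w : ℝ × ℝ} {s : ℝ} (hv : v ≠ 0)
    (hw : w ≠ 0) (hr : 0 ≤ r) (hc : signedDist v c = r - s)
    (h : Disjoint (horodisk v s) (horodisk w s)) : -r - s ≤ signedDist w c := by
  by_contra! hlt
  set ε := (-r - s - signedDist w c) / 2 with hε
  have hε0 : 0 < ε := by linarith
  obtain ⟨p, hp1, hp2⟩ := exists_dist_eq_abs_signedDist_eq hv c (r + ε)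
  rw [abs_of_nonneg (by linarith)] at hp1
  have h1 := abs_signedDist_sub_le hw p c
  have h2 := le_abs_self (signedDist w p - signedDist w c)
  have hpv : signedDist v p < -s := by linarith
  have hpw : signedDist w p < -s := by linarith
  exact Set.disjoint_left.1 h hpv hpw

/-! ### Points of `ℍ` as quadratic forms on `ℝ²` -/

theorem signedDist_eq_log {a b : ℝ} (z : ℍ) : signedDist (a, b) z =
    Real.log ((a ^ 2 - 2 * a * b * z.re + b ^ 2 * (z.re ^ 2 + z.im ^ 2)) / z.im) := by
  unfold signedDist
  congr 2
  simp [Complex.normSq_apply]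
  ring

/-- The quadratic form whose logarithm is the signed distance. -/
noncomputable def horoForm (z : ℍ) (v : ℝ × ℝ) : ℝ :=
  (v.1 ^ 2 - 2 * v.1 * v.2 * z.re + v.2 ^ 2 * (z.re ^ 2 + z.im ^ 2)) / z.im

theorem signedDist_eq_log_horoForm (v : ℝ × ℝ) (z : ℍ) :
    signedDist v z = Real.log (horoForm z v) :=
  signedDist_eq_log z

theorem horoForm_pos (z : ℍ) {v : ℝ × ℝ} (hv : v ≠ 0) : 0 < horoForm z v := by
  have hz := z.im_pos
  refine div_pos ?_ hz
  rcases eq_or_ne v.2 0 with h | h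
  · have h1 : v.1 ≠ 0 := fun h1 => hv (Prod.ext h1 h)
    rw [h]
    have := pow_pos (abs_pos.2 h1) 2
    rw [sq_abs] at this
    simpa using this
  · have := mul_pos (pow_pos (abs_pos.2 h) 2) (pow_pos hz 2)
    rw [sq_abs] at this
    nlinarith [sq_nonneg (v.1 - v.2 * z.re)]

/-- Cauchy–Schwarz for a form of determinant one: the difference of the two sides is the square of
its polar form at `v, w`. -/
theorem det_sq_le_horoForm_mul (z : ℍ) (v w : ℝ × ℝ) :
    det v w ^ 2 ≤ horoForm z v * horoForm z w := by
  have hz := z.im_pos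
  unfold horoForm det
  rw [div_mul_div_comm, le_div_iff₀ (by positivity)]
  nlinarith [sq_nonneg ((v.1 - v.2 * z.re) * (w.1 - w.2 * z.re) + v.2 * w.2 * z.im ^ 2)]

theorem disjoint_horodisk {v w : ℝ × ℝ} {s : ℝ} (hv : v ≠ 0) (hw : w ≠ 0)
    (h : Real.exp (-s) ≤ |det v w|) : Disjoint (horodisk v s) (horodisk w s) := by
  rw [Set.disjoint_left]
  intro z hz hz'
  have h1 : signedDist v z < -s := hz
  have h2 : signedDist w z < -s := hz'
  rw [signedDist_eq_log_horoForm, Real.log_lt_iff_lt_exp (horoForm_pos z hv)] at h1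
  rw [signedDist_eq_log_horoForm, Real.log_lt_iff_lt_exp (horoForm_pos z hw)] at h2
  have h3 := det_sq_le_horoForm_mul z v w
  have h4 := mul_lt_mul'' h1 h2 (horoForm_pos z hv).le (horoForm_pos z hw).le
  have h5 := mul_self_le_mul_self (Real.exp_pos (-s)).le h
  rw [abs_mul_abs_self] at h5
  nlinarith

theorem horocycle_neg (v : ℝ × ℝ) (s : ℝ) : horocycle (-v) s = horocycle v s := by
  ext z
  change signedDist (-v) z = -s ↔ signedDist v z = -s
  rw [signedDist_eq_log_horoForm, signedDist_eq_log_horoForm]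
  simp [horoForm]

/-- A horocycle determines its signed distance function. -/
theorem signedDist_eq_of_horocycle_eq {v w : ℝ × ℝ} {s : ℝ} (hv : v ≠ 0)
    (h : horocycle v s = horocycle w s) (hw : w ≠ 0) (z : ℍ) :
    signedDist v z = signedDist w z := by
  obtain ⟨g, hg⟩ := exists_specialLinearGroup_apply_eq hv
  obtain ⟨w', hw'⟩ : ∃ w', w' = (g 0 0 * w.1 + g 0 1 * w.2, g 1 0 * w.1 + g 1 1 * w.2) :=
    ⟨_, rfl⟩
  have h1 : ∀ z, signedDist v z = signedDist (1, 0) (g • z) := fun z => by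
    rw [← hg, signedDist_smul]
  have h2 : ∀ z, signedDist w z = signedDist w' (g • z) := fun z => by
    rw [hw', signedDist_smul]
  have hY : 0 < Real.exp s := Real.exp_pos s
  -- In the coordinate of `g` the horocycle of `v` is the line at height `exp s`, so the signed
  -- distance to `w'` is constant on that line. This forces `w' = (±1, 0)`.
  have key : ∀ x : ℝ, horoForm ⟨⟨x, Real.exp s⟩, hY⟩ w' = Real.exp (-s) := by
    intro x
    have hm : g⁻¹ • (⟨⟨x, Real.exp s⟩, hY⟩ : ℍ) ∈ horocycle v s := by
      change signedDist v _ = -s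
      rw [h1, smul_inv_smul, signedDist_one_zero]
      simp [UpperHalfPlane.im]
    rw [h] at hm
    have hm' : signedDist w _ = -s := hm
    have hw0 : w' ≠ 0 := by
      intro h0
      have hd := g.det_coe
      rw [Matrix.det_fin_two] at hd
      have e1 : g 0 0 * w.1 + g 0 1 * w.2 = 0 := by
        have := congrArg Prod.fst (hw'.symm.trans h0); simpa using this
      have e2 : g 1 0 * w.1 + g 1 1 * w.2 = 0 := by
        have := congrArg Prod.snd (hw'.symm.trans h0); simpa using this
      apply hw
      ext
      · change w.1 = 0
        linear_combination (-w.1) * hd + g 1 1 * e1 - g 0 1 * e2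
      · change w.2 = 0
        linear_combination (-w.2) * hd + g 0 0 * e2 - g 1 0 * e1
    rw [h2, smul_inv_smul, signedDist_eq_log_horoForm] at hm'
    rw [← hm', Real.exp_log (horoForm_pos _ hw0)]
  have hval : ∀ x : ℝ,
      w'.1 ^ 2 - 2 * w'.1 * w'.2 * x + w'.2 ^ 2 * (x ^ 2 + Real.exp s ^ 2) = 1 := by
    intro x
    have := key x
    unfold horoForm at this
    rw [div_eq_iff (ne_of_gt (UpperHalfPlane.im_pos _))] at this
    simp only [UpperHalfPlane.re, UpperHalfPlane.im] at this
    rw [this, ← Real.exp_add]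
    simp
  have hb : w'.2 = 0 := by
    have := hval 0
    have := hval 1
    have := hval (-1)
    nlinarith
  have ha : w'.1 ^ 2 = 1 := by simpa [hb] using hval 0
  rw [h1, h2, signedDist_eq_log_horoForm, signedDist_eq_log_horoForm]
  simp [horoForm, hb, ha]

end Hyp

/-! ## The local Delaunay condition -/

namespace Triangulation

variable {T : Type*} {Δ : Triangulation T}

theorem ell_pos (lam : Δ.Edge → ℝ) (e : Δ.Edge) : 0 < ell lam e := Real.exp_pos _

theorem edge_eq_of_glue {t t' : T} {i j : Fin 3} (h : Δ.glue (t, i) = (t', j)) :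
    Δ.edge t' j = Δ.edge t i :=
  (Quot.sound (r := fun d d' => Δ.glue d = d') h).symm

/-- The cosine of the angle opposite to the side `d` of a triangle with side lengths `ℓ`. -/
noncomputable def cornerCos (ℓ : Δ.Edge → ℝ) (d : T × Fin 3) : ℝ :=
  (ℓ (Δ.edge d.1 (d.2 + 1)) ^ 2 + ℓ (Δ.edge d.1 (d.2 + 2)) ^ 2 - ℓ (Δ.edge d.1 d.2) ^ 2) /
    (2 * ℓ (Δ.edge d.1 (d.2 + 1)) * ℓ (Δ.edge d.1 (d.2 + 2)))

/-- The two angles opposite to every edge add up to at most `π`. -/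
def LocallyDelaunay (ℓ : Δ.Edge → ℝ) : Prop :=
  ∀ d, 0 ≤ cornerCos ℓ d + cornerCos ℓ (Δ.glue d)

theorem fin_three_add (i : Fin 3) :
    i + 1 + 1 = i + 2 ∧ i + 1 + 2 = i ∧ i + 2 + 1 = i ∧ i + 2 + 2 = i + 1 := by
  decide +revert

theorem fin_three_add_ne (i : Fin 3) : i + 1 ≠ i ∧ i + 2 ≠ i ∧ i + 2 ≠ i + 1 := by
  decide +revert

theorem fin_three_cases (i j : Fin 3) : j = i ∨ j = i + 1 ∨ j = i + 2 := by
  decide +revert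

theorem TriangleInequalities.sq_cornerCos_lt_one {ℓ : Δ.Edge → ℝ} (h : TriangleInequalities ℓ)
    (hℓ : ∀ e, 0 < ℓ e) (d : T × Fin 3) : cornerCos ℓ d ^ 2 < 1 := by
  obtain ⟨t, i⟩ := d
  have h0 := h t i
  have h1 := h t (i + 1)
  have h2 := h t (i + 2)
  obtain ⟨e1, e2, e3, e4⟩ := fin_three_add i
  rw [e1, e2] at h1
  rw [e3, e4] at h2
  have p0 := hℓ (Δ.edge t i)
  have p1 := hℓ (Δ.edge t (i + 1))
  have p2 := hℓ (Δ.edge t (i + 2))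
  rw [sq_lt_one_iff_abs_lt_one, abs_lt]
  unfold cornerCos
  dsimp only
  generalize ℓ (Δ.edge t i) = a at *
  generalize ℓ (Δ.edge t (i + 1)) = b at *
  generalize ℓ (Δ.edge t (i + 2)) = c at *
  constructor
  · rw [lt_div_iff₀ (by positivity)]; nlinarith
  · rw [div_lt_iff₀ (by positivity)]; nlinarith

/-- Only `-1 < cos` is needed at each corner: it says that the opposite side squared is less than
the square of the sum of the other two. -/
theorem triangleInequalities_of_sq_cornerCos_lt_one {ℓ : Δ.Edge → ℝ} (hℓ : ∀ e, 0 < ℓ e)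
    (h : ∀ d, cornerCos ℓ d ^ 2 < 1) : TriangleInequalities ℓ := by
  intro t i
  have h0 := h (t, i)
  have p0 := hℓ (Δ.edge t i)
  have p1 := hℓ (Δ.edge t (i + 1))
  have p2 := hℓ (Δ.edge t (i + 2))
  rw [sq_lt_one_iff_abs_lt_one, abs_lt] at h0
  have h1 := h0.1
  unfold cornerCos at h1
  dsimp only at h1
  generalize ℓ (Δ.edge t i) = a at *
  generalize ℓ (Δ.edge t (i + 1)) = b at *
  generalize ℓ (Δ.edge t (i + 2)) = c at *
  rw [lt_div_iff₀ (by positivity)] at h1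
  nlinarith

/-! ### The quadratic form circumscribed about an ideal triangle -/

namespace IdealTriangle

variable {lam : Δ.Edge → ℝ}

/-- The side `j` of `τ` is attached to the side `i` of `σ`. -/
def AdjAt (σ : IdealTriangle lam) (i : Fin 3) (τ : IdealTriangle lam) (j : Fin 3) : Prop :=
  Δ.glue (σ.tri, i) = (τ.tri, j) ∧
    τ.vec (j + 1) = σ.vec (i + 2) ∧ τ.vec (j + 2) = -σ.vec (i + 1)

theorem vec_ne_zero (σ : IdealTriangle lam) (k : Fin 3) : σ.vec k ≠ 0 := by
  intro h
  have h1 := σ.det_eq (k + 2)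
  rw [(fin_three_add k).2.2.1, h] at h1
  have := ell_pos lam (Δ.edge σ.tri (k + 2))
  simp [Hyp.det] at h1
  linarith

theorem det_vec_add_two (σ : IdealTriangle lam) (i : Fin 3) :
    Hyp.det (σ.vec (i + 2)) (σ.vec i) = ell lam (Δ.edge σ.tri (i + 1)) := by
  rw [← σ.det_eq, (fin_three_add i).1, (fin_three_add i).2.1]

theorem det_vec_add_one (σ : IdealTriangle lam) (i : Fin 3) :
    Hyp.det (σ.vec i) (σ.vec (i + 1)) = ell lam (Δ.edge σ.tri (i + 2)) := by
  rw [← σ.det_eq, (fin_three_add i).2.2.1, (fin_three_add i).2.2.2]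

/-- This is the linear relation between three vectors of the plane, whose coefficients are their
pairwise determinants, paired with `w`. -/
theorem ell_mul_det_add (σ : IdealTriangle lam) (i : Fin 3) (w : ℝ × ℝ) :
    ell lam (Δ.edge σ.tri i) * Hyp.det (σ.vec i) w +
      ell lam (Δ.edge σ.tri (i + 1)) * Hyp.det (σ.vec (i + 1)) w +
        ell lam (Δ.edge σ.tri (i + 2)) * Hyp.det (σ.vec (i + 2)) w = 0 := by
  rw [← σ.det_eq, ← σ.det_vec_add_two, ← σ.det_vec_add_one]
  unfold Hyp.det
  ring

/-- The quadratic form taking the value `1` at the three vectors of `σ`, written in terms of the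
side `i`. -/
noncomputable def sideForm (σ : IdealTriangle lam) (i : Fin 3) (w : ℝ × ℝ) : ℝ :=
  (Hyp.det (σ.vec (i + 1)) w ^ 2 + Hyp.det (σ.vec (i + 2)) w ^ 2 +
    2 * cornerCos (ell lam) (σ.tri, i) * Hyp.det (σ.vec (i + 1)) w * Hyp.det (σ.vec (i + 2)) w) /
      ell lam (Δ.edge σ.tri i) ^ 2

theorem sideForm_add_one (σ : IdealTriangle lam) (i : Fin 3) (w : ℝ × ℝ) :
    σ.sideForm (i + 1) w = σ.sideForm i w := by
  have h := σ.ell_mul_det_add i w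
  unfold sideForm cornerCos
  dsimp only
  obtain ⟨e1, e2, -, -⟩ := fin_three_add i
  rw [e1, e2]
  have p0 := ell_pos lam (Δ.edge σ.tri i)
  have p1 := ell_pos lam (Δ.edge σ.tri (i + 1))
  have p2 := ell_pos lam (Δ.edge σ.tri (i + 2))
  generalize ell lam (Δ.edge σ.tri i) = a at *
  generalize ell lam (Δ.edge σ.tri (i + 1)) = b at *
  generalize ell lam (Δ.edge σ.tri (i + 2)) = c at *
  generalize Hyp.det (σ.vec i) w = x at *
  generalize Hyp.det (σ.vec (i + 1)) w = y at *
  generalize Hyp.det (σ.vec (i + 2)) w = z at *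
  obtain rfl : x = -(b * y + c * z) / a := by
    field_simp; linarith
  field_simp
  ring

/-- The quadratic form taking the value `1` at the three vectors of `σ`. -/
noncomputable def circumForm (σ : IdealTriangle lam) (w : ℝ × ℝ) : ℝ := σ.sideForm 0 w

theorem circumForm_eq_sideForm (σ : IdealTriangle lam) (i : Fin 3) (w : ℝ × ℝ) :
    σ.circumForm w = σ.sideForm i w := by
  have h1 := σ.sideForm_add_one 0 w
  have h2 := σ.sideForm_add_one 1 w
  unfold circumForm
  rcases fin_three_cases 0 i with rfl | rfl | rfl
  · rfl
  · exact h1.symm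
  · exact (h2.trans h1).symm

theorem det_self (v : ℝ × ℝ) : Hyp.det v v = 0 := by
  unfold Hyp.det; ring

theorem circumForm_vec (σ : IdealTriangle lam) (k : Fin 3) : σ.circumForm (σ.vec k) = 1 := by
  rw [σ.circumForm_eq_sideForm (k + 1), sideForm, (fin_three_add k).1, (fin_three_add k).2.1,
    det_self, σ.det_vec_add_two]
  have := ell_pos lam (Δ.edge σ.tri (k + 1))
  field_simp
  ring

/-- The product of the determinants with the two vectors on the side `i`. It is negative on the
vectors centered on the same side as `σ` and positive on those on the other side. -/
def sideProd (σ : IdealTriangle lam) (i : Fin 3) (w : ℝ × ℝ) : ℝ :=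
  Hyp.det (σ.vec (i + 1)) w * Hyp.det (σ.vec (i + 2)) w

theorem AdjAt.sideProd_eq {σ τ : IdealTriangle lam} {i j : Fin 3} (h : σ.AdjAt i τ j)
    (w : ℝ × ℝ) : τ.sideProd j w = -σ.sideProd i w := by
  unfold sideProd
  rw [h.2.1, h.2.2]
  simp [Hyp.det]
  ring

theorem sideProd_vec_neg (σ : IdealTriangle lam) (i : Fin 3) : σ.sideProd i (σ.vec i) < 0 := by
  unfold sideProd
  have h : Hyp.det (σ.vec (i + 1)) (σ.vec i) = -Hyp.det (σ.vec i) (σ.vec (i + 1)) := by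
    unfold Hyp.det; ring
  rw [h, σ.det_vec_add_two, σ.det_vec_add_one]
  have := mul_pos (ell_pos lam (Δ.edge σ.tri (i + 1))) (ell_pos lam (Δ.edge σ.tri (i + 2)))
  linarith

theorem sideProd_vec_nonpos (σ : IdealTriangle lam) (i k : Fin 3) :
    σ.sideProd i (σ.vec k) ≤ 0 := by
  rcases fin_three_cases i k with rfl | rfl | rfl
  · exact (σ.sideProd_vec_neg _).le
  · simp [sideProd, det_self]
  · simp [sideProd, det_self]

/-- A center beyond one side of an ideal triangle cannot be beyond another one. Multiplying the
linear relation by one of the determinants shows this. -/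
theorem sideProd_nonpos_of_nonneg (σ : IdealTriangle lam) {i j : Fin 3} (hij : j ≠ i)
    {w : ℝ × ℝ} (h : 0 ≤ σ.sideProd i w) : σ.sideProd j w ≤ 0 := by
  have hp := σ.ell_mul_det_add i w
  have p0 := ell_pos lam (Δ.edge σ.tri i)
  have p1 := ell_pos lam (Δ.edge σ.tri (i + 1))
  have p2 := ell_pos lam (Δ.edge σ.tri (i + 2))
  obtain ⟨e1, e2, e3, e4⟩ := fin_three_add i
  unfold sideProd at *
  rcases fin_three_cases i j with rfl | rfl | rfl
  · exact absurd rfl hij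
  · rw [e1, e2]
    generalize ell lam (Δ.edge σ.tri i) = a at *
    generalize ell lam (Δ.edge σ.tri (i + 1)) = b at *
    generalize ell lam (Δ.edge σ.tri (i + 2)) = c at *
    generalize Hyp.det (σ.vec i) w = x at *
    generalize Hyp.det (σ.vec (i + 1)) w = y at *
    generalize Hyp.det (σ.vec (i + 2)) w = z at *
    have : a * (z * x) = -b * (y * z) - c * z ^ 2 := by linear_combination z * hp
    have h2 : a * (z * x) ≤ 0 := by nlinarith [mul_nonneg p1.le h, mul_nonneg p2.le (sq_nonneg z)]
    exact nonpos_of_mul_nonpos_right h2 p0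
  · rw [e3, e4]
    generalize ell lam (Δ.edge σ.tri i) = a at *
    generalize ell lam (Δ.edge σ.tri (i + 1)) = b at *
    generalize ell lam (Δ.edge σ.tri (i + 2)) = c at *
    generalize Hyp.det (σ.vec i) w = x at *
    generalize Hyp.det (σ.vec (i + 1)) w = y at *
    generalize Hyp.det (σ.vec (i + 2)) w = z at *
    have : a * (x * y) = -c * (y * z) - b * y ^ 2 := by linear_combination y * hp
    have h2 : a * (x * y) ≤ 0 := by nlinarith [mul_nonneg p2.le h, mul_nonneg p1.le (sq_nonneg y)]
    exact nonpos_of_mul_nonpos_right h2 p0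

/-- Both forms are `1` at the two vectors of the common side, so their difference is a multiple of
the product of the two determinants that vanish there. The factor is read off from `sideForm`. -/
theorem AdjAt.circumForm_sub {σ τ : IdealTriangle lam} {i j : Fin 3} (h : σ.AdjAt i τ j)
    (w : ℝ × ℝ) : σ.circumForm w - τ.circumForm w =
      2 * (cornerCos (ell lam) (σ.tri, i) + cornerCos (ell lam) (τ.tri, j)) * σ.sideProd i w /
        ell lam (Δ.edge σ.tri i) ^ 2 := by
  have hp := ell_pos lam (Δ.edge σ.tri i)
  have hn : Hyp.det (-σ.vec (i + 1)) w = -Hyp.det (σ.vec (i + 1)) w := by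
    simp [Hyp.det]; ring
  rw [σ.circumForm_eq_sideForm i, τ.circumForm_eq_sideForm j, sideForm, sideForm, sideProd,
    edge_eq_of_glue h.1, h.2.1, h.2.2, hn]
  field_simp
  ring

theorem horoForm_eq_of_const (σ : IdealTriangle lam) {c : UpperHalfPlane} {ρ : ℝ} (hρ : 0 < ρ)
    (h : ∀ k, Hyp.horoForm c (σ.vec k) = ρ) :
    (∀ w, Hyp.horoForm c w = ρ * σ.circumForm w) ∧
      ∀ i, cornerCos (ell lam) (σ.tri, i) ^ 2 < 1 := by
  have hy := c.im_pos
  -- `B` is the polar form of `horoForm c` at the two vectors of side `i`. The first equation is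
  -- determinant one; the second expands `w` in these vectors. Testing at the third vector then
  -- gives `B = -ρ * cos`, and `cos ^ 2 < 1` follows.
  have hpolar : ∀ i, ∃ B, ρ ^ 2 - B ^ 2 = ell lam (Δ.edge σ.tri i) ^ 2 ∧
      ∀ w, ell lam (Δ.edge σ.tri i) ^ 2 * Hyp.horoForm c w =
        ρ * (Hyp.det (σ.vec (i + 1)) w ^ 2 + Hyp.det (σ.vec (i + 2)) w ^ 2) -
          2 * Hyp.det (σ.vec (i + 1)) w * Hyp.det (σ.vec (i + 2)) w * B := by
    intro i
    obtain ⟨a, ha⟩ : ∃ a, a = σ.vec (i + 1) := ⟨_, rfl⟩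
    obtain ⟨b, hb⟩ : ∃ b, b = σ.vec (i + 2) := ⟨_, rfl⟩
    have hHa := h (i + 1)
    have hHb := h (i + 2)
    have hdet := σ.det_eq i
    rw [← ha] at hHa hdet
    rw [← hb] at hHb hdet
    rw [← ha, ← hb]
    refine ⟨(a.1 * b.1 - (a.1 * b.2 + a.2 * b.1) * c.re +
      a.2 * b.2 * (c.re ^ 2 + c.im ^ 2)) / c.im, ?_, fun w => ?_⟩
    · rw [← hdet]
      have : ρ ^ 2 = Hyp.horoForm c a * Hyp.horoForm c b := by rw [hHa, hHb]; ring
      rw [this]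
      unfold Hyp.horoForm Hyp.det
      field_simp
      ring
    · rw [← hdet]
      have : ρ * (Hyp.det a w ^ 2 + Hyp.det b w ^ 2) =
          Hyp.horoForm c b * Hyp.det a w ^ 2 + Hyp.horoForm c a * Hyp.det b w ^ 2 := by
        rw [hHa, hHb]; ring
      rw [this]
      unfold Hyp.horoForm Hyp.det
      field_simp
      ring
  have hcos : ∀ i, (∀ w, Hyp.horoForm c w = ρ * σ.circumForm w) ∧
      cornerCos (ell lam) (σ.tri, i) ^ 2 < 1 := by
    intro i
    obtain ⟨B, hB1, hB2⟩ := hpolar i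
    have p0 := ell_pos lam (Δ.edge σ.tri i)
    have p1 := ell_pos lam (Δ.edge σ.tri (i + 1))
    have p2 := ell_pos lam (Δ.edge σ.tri (i + 2))
    have hBc : B = -ρ * cornerCos (ell lam) (σ.tri, i) := by
      have h1 := hB2 (σ.vec i)
      have h2 : Hyp.det (σ.vec (i + 1)) (σ.vec i) = -Hyp.det (σ.vec i) (σ.vec (i + 1)) := by
        unfold Hyp.det; ring
      rw [h i, h2, σ.det_vec_add_two, σ.det_vec_add_one] at h1
      unfold cornerCos
      dsimp only
      field_simp
      linarith
    refine ⟨fun w => ?_, ?_⟩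
    · have h1 := hB2 w
      rw [σ.circumForm_eq_sideForm i, sideForm]
      rw [hBc] at h1
      field_simp
      linarith
    · rw [hBc] at hB1
      have h3 : 0 < ρ ^ 2 * (1 - cornerCos (ell lam) (σ.tri, i) ^ 2) := by
        have : 0 < ell lam (Δ.edge σ.tri i) ^ 2 := by positivity
        linarith
      linarith [pos_of_mul_pos_right h3 (by positivity)]
  exact ⟨(hcos 0).1, fun i => (hcos i).2⟩

/-- The triangle inequalities make `circumForm` positive definite, hence proportional to the form of
a point. The bound on `ρ` later keeps the radius of the touching circle positive. -/
theorem exists_horoForm_eq (σ : IdealTriangle lam) (h : TriangleInequalities (ell lam)) :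
    ∃ (c : UpperHalfPlane) (ρ : ℝ), 0 < ρ ∧ (∀ w, Hyp.horoForm c w = ρ * σ.circumForm w) ∧
      ∀ i, ell lam (Δ.edge σ.tri i) ≤ ρ := by
  have hk := h.sq_cornerCos_lt_one (ell_pos lam) (σ.tri, 0)
  set k := cornerCos (ell lam) (σ.tri, 0) with hkdef
  have p0 := ell_pos lam (Δ.edge σ.tri 0)
  set e := ell lam (Δ.edge σ.tri 0) with he
  have hdet := σ.det_eq 0
  rw [← he] at hdet
  obtain ⟨a, ha⟩ : ∃ a, a = σ.vec (0 + 1) := ⟨_, rfl⟩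
  obtain ⟨b, hb⟩ : ∃ b, b = σ.vec (0 + 2) := ⟨_, rfl⟩
  have hform : ∀ w, σ.circumForm w = (Hyp.det a w ^ 2 + Hyp.det b w ^ 2 +
      2 * k * Hyp.det a w * Hyp.det b w) / e ^ 2 := by
    intro w; rw [ha, hb]; rfl
  rw [← ha, ← hb] at hdet
  set A := a.2 ^ 2 + b.2 ^ 2 + 2 * k * a.2 * b.2 with hA
  set B := a.1 * a.2 + b.1 * b.2 + k * (a.1 * b.2 + a.2 * b.1) with hB
  set C := a.1 ^ 2 + b.1 ^ 2 + 2 * k * a.1 * b.1 with hC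
  have hdisc : A * C - B ^ 2 = (1 - k ^ 2) * e ^ 2 := by
    rw [← hdet, hA, hB, hC]; unfold Hyp.det; ring
  have hdisc0 : 0 < A * C - B ^ 2 := by
    rw [hdisc]; exact mul_pos (by linarith) (by positivity)
  have hA0 : 0 < A := by
    have h1 : 0 ≤ A := by
      have : A = (a.2 + k * b.2) ^ 2 + (1 - k ^ 2) * b.2 ^ 2 := by rw [hA]; ring
      rw [this]
      have : 0 ≤ (1 - k ^ 2) * b.2 ^ 2 := mul_nonneg (by linarith) (sq_nonneg _)
      positivity
    rcases h1.lt_or_eq with h1 | h1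
    · exact h1
    · rw [← h1] at hdisc0
      nlinarith [sq_nonneg B]
  set D := √(A * C - B ^ 2) with hD
  have hD0 : 0 < D := Real.sqrt_pos.2 hdisc0
  have hD2 : D ^ 2 = A * C - B ^ 2 := Real.sq_sqrt hdisc0.le
  -- The center is the root in `ℍ` of `A * z ^ 2 - 2 * B * z + C`.
  let c : UpperHalfPlane := ⟨⟨B / A, D / A⟩, div_pos hD0 hA0⟩
  have hre : c.re = B / A := rfl
  have him : c.im = D / A := rfl
  have hw : ∀ w, Hyp.horoForm c w = e ^ 2 / D * σ.circumForm w := by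
    intro w
    have h1 : σ.circumForm w = (A * w.1 ^ 2 - 2 * B * w.1 * w.2 + C * w.2 ^ 2) / e ^ 2 := by
      rw [hform, hA, hB, hC]; unfold Hyp.det; ring
    rw [h1]
    unfold Hyp.horoForm
    rw [hre, him]
    have h2 : (B / A) ^ 2 + (D / A) ^ 2 = C / A := by
      field_simp
      linarith
    rw [h2]
    field_simp
  have hρ : 0 < e ^ 2 / D := by positivity
  refine ⟨c, e ^ 2 / D, hρ, hw, fun i => ?_⟩
  have h1 := Hyp.det_sq_le_horoForm_mul c (σ.vec (i + 1)) (σ.vec (i + 2))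
  rw [σ.det_eq, hw, hw, circumForm_vec, circumForm_vec, mul_one] at h1
  exact abs_le_of_sq_le_sq' (by rw [sq (e ^ 2 / D)]; exact h1) hρ.le |>.2

end IdealTriangle

end Triangulation

/-! ## Reduced paths of triangles -/

/-- `y` is reached from `x₀` by a path of triangles that never turns back, entering `y` through the
given side (`none` if the path is constant). Here `R x i y j` says that the sides `i` of `x` and `j`
of `y` are attached to each other. -/
inductive ReducedPath {X : Type*} (R : X → Fin 3 → X → Fin 3 → Prop) (x₀ : X) :
    X → Option (Fin 3) → Prop
  | base : ReducedPath R x₀ x₀ none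
  | step {x o i y j} : ReducedPath R x₀ x o → o ≠ some i → R x i y j →
      ReducedPath R x₀ y (some j)

/-- Every path can be reduced, up to an equivalence relation compatible with `R`. -/
theorem ReducedPath.exists_of_reflTransGen {X : Type*} {R : X → Fin 3 → X → Fin 3 → Prop}
    {E : X → X → Prop} (hE : Equivalence E)
    (hlift : ∀ {x x' i y' j}, E x x' → R x' i y' j → ∃ y, E y y' ∧ R x i y j)
    (hback : ∀ {x i y j z k}, R x i y j → R y j z k → E x z) {x₀ y : X}
    (h : Relation.ReflTransGen (fun a b => ∃ i j, R a i b j) x₀ y) :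
    ∃ y' o, E y' y ∧ ReducedPath R x₀ y' o := by
  induction h with
  | refl => exact ⟨x₀, none, hE.refl _, .base⟩
  | tail _ hbc ih =>
    obtain ⟨x, o, hx, hr⟩ := ih
    obtain ⟨i, j, hij⟩ := hbc
    obtain ⟨y, hy, hxy⟩ := hlift hx hij
    -- If the new step leaves through the side of entry, it undoes the last step, and the path
    -- before that step serves.
    by_cases ho : o = some i
    · subst ho
      cases hr with
      | step hp _ hpx => exact ⟨_, _, hE.trans (hback hpx hxy) hy, hp⟩
    · exact ⟨y, some j, hy, .step hr ho hxy⟩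

/-! ## Lifted triangulations of the hyperbolic plane -/

namespace Triangulation

variable {T : Type*} {Δ : Triangulation T}

namespace IdealTriangle

variable {lam : Δ.Edge → ℝ}

/-! ### Signs, neighbors and lifts -/

theorem ext_vec {σ τ : IdealTriangle lam} (h : σ.tri = τ.tri) (h' : ∀ k, σ.vec k = τ.vec k) :
    σ = τ := by
  obtain ⟨t, v, hv⟩ := σ
  obtain ⟨t', v', hv'⟩ := τ
  obtain rfl : t = t' := h
  obtain rfl : v = v' := funext h'
  rfl

theorem ext_side {σ τ : IdealTriangle lam} (h : σ.tri = τ.tri) (i : Fin 3)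
    (h1 : σ.vec (i + 1) = τ.vec (i + 1)) (h2 : σ.vec (i + 2) = τ.vec (i + 2)) : σ = τ := by
  refine ext_vec h fun k => ?_
  rcases fin_three_cases i k with rfl | rfl | rfl
  · have hp := ell_pos lam (Δ.edge σ.tri k)
    have e := σ.det_eq k
    have a1 := σ.det_vec_add_one k
    have a2 := σ.det_vec_add_two k
    have b1 := τ.det_vec_add_one k
    have b2 := τ.det_vec_add_two k
    rw [← h, ← h1] at b1
    rw [← h, ← h2] at b2
    rw [← e] at hp
    have c1 := a1.trans b1.symm
    have c2 := a2.trans b2.symm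
    unfold Hyp.det at *
    ext
    · apply mul_left_cancel₀ hp.ne'
      linear_combination (-(σ.vec (k + 1)).1) * c2 - (σ.vec (k + 2)).1 * c1
    · apply mul_left_cancel₀ hp.ne'
      linear_combination (-(σ.vec (k + 1)).2) * c2 - (σ.vec (k + 2)).2 * c1
  · exact h1
  · exact h2

/-- The same triangle with the opposite signs of all vectors. -/
def neg (σ : IdealTriangle lam) : IdealTriangle lam where
  tri := σ.tri
  vec k := -σ.vec k
  det_eq i := by
    rw [← σ.det_eq i]
    simp [Hyp.det]

theorem neg_neg (σ : IdealTriangle lam) : σ.neg.neg = σ :=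
  ext_vec rfl fun _ => _root_.neg_neg _

theorem AdjAt.adj {σ τ : IdealTriangle lam} {i j : Fin 3} (h : σ.AdjAt i τ j) : σ.Adj i τ :=
  ⟨j, h⟩

theorem AdjAt.neg {σ τ : IdealTriangle lam} {i j : Fin 3} (h : σ.AdjAt i τ j) :
    σ.neg.AdjAt i τ.neg j :=
  ⟨h.1, congrArg Neg.neg h.2.1, congrArg Neg.neg h.2.2⟩

/-- The sign in the attaching rule makes crossing a side and returning reverse all vectors, so paths
of lifts can be reversed and reduced only up to sign. -/
theorem AdjAt.symm_neg {σ τ : IdealTriangle lam} {i j : Fin 3} (h : σ.AdjAt i τ j) :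
    τ.AdjAt j σ.neg i := by
  refine ⟨?_, h.2.2.symm, congrArg Neg.neg h.2.1.symm⟩
  rw [← h.1, Δ.glue_glue]
  rfl

theorem AdjAt.eq_neg_of_adjAt {σ τ ρ : IdealTriangle lam} {i j k : Fin 3} (h : σ.AdjAt i τ j)
    (h' : τ.AdjAt j ρ k) : ρ = σ.neg := by
  have h0 := h.symm_neg
  have hg := h'.1.symm.trans h0.1
  obtain rfl : k = i := congrArg Prod.snd hg
  refine ext_side (congrArg Prod.fst hg) k ?_ ?_
  · rw [h'.2.1, h0.2.1]
  · rw [h'.2.2, h0.2.2]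

/-- Equality up to sign. -/
def EqUpToSign (σ τ : IdealTriangle lam) : Prop := τ = σ ∨ τ = σ.neg

theorem eqUpToSign_equivalence : Equivalence (EqUpToSign (lam := lam)) where
  refl _ := Or.inl rfl
  symm := by
    rintro x y (rfl | rfl)
    · exact Or.inl rfl
    · exact Or.inr x.neg_neg.symm
  trans := by
    rintro x y z (rfl | rfl) (rfl | rfl)
    · exact Or.inl rfl
    · exact Or.inr rfl
    · exact Or.inr rfl
    · exact Or.inl x.neg_neg

theorem exists_tri_vec_eq (t : T) (j : Fin 3) {p q : ℝ × ℝ}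
    (h : Hyp.det p q = ell lam (Δ.edge t j)) :
    ∃ τ : IdealTriangle lam, τ.tri = t ∧ τ.vec (j + 1) = p ∧ τ.vec (j + 2) = q := by
  obtain ⟨n1, n2, n3⟩ := fin_three_add_ne j
  have hp := ell_pos lam (Δ.edge t j)
  obtain ⟨e1, e2, e3, e4⟩ := fin_three_add j
  -- The third vector is forced by the linear relation behind `ell_mul_det_add`.
  let r : ℝ × ℝ := (-(ell lam (Δ.edge t (j + 1)) * p.1 + ell lam (Δ.edge t (j + 2)) * q.1) /
    ell lam (Δ.edge t j), -(ell lam (Δ.edge t (j + 1)) * p.2 + ell lam (Δ.edge t (j + 2)) * q.2) /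
    ell lam (Δ.edge t j))
  refine ⟨⟨t, fun k => if k = j then r else if k = j + 1 then p else q, fun i => ?_⟩, rfl, ?_, ?_⟩
  · rcases fin_three_cases j i with rfl | rfl | rfl
    · simp [n1, n2, n3, h]
    · simp only [e1, e2, n2, n3, if_true, if_false]
      unfold Hyp.det at *
      dsimp only [r]
      field_simp
      linear_combination ell lam (Δ.edge t (j + 1)) * h
    · simp only [e3, e4, n1, if_true, if_false]
      unfold Hyp.det at *
      dsimp only [r]
      field_simp
      linear_combination ell lam (Δ.edge t (j + 2)) * h
  · simp [n1]
  · simp [n2, n3]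

theorem exists_adjAt (σ : IdealTriangle lam) (i : Fin 3) :
    ∃ τ, ∃ j, σ.AdjAt i τ j := by
  obtain ⟨⟨t, j⟩, hg⟩ : ∃ d, Δ.glue (σ.tri, i) = d := ⟨_, rfl⟩
  obtain ⟨τ, h0, h1, h2⟩ := exists_tri_vec_eq (lam := lam) t j
    (p := σ.vec (i + 2)) (q := -σ.vec (i + 1)) (by
      rw [edge_eq_of_glue hg, ← σ.det_eq]
      simp [Hyp.det]; ring)
  exact ⟨τ, j, by rw [hg, h0], h1, h2⟩

theorem nonempty_of_nonempty [Nonempty T] : Nonempty (IdealTriangle lam) := by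
  obtain ⟨t⟩ := ‹Nonempty T›
  obtain ⟨τ, -⟩ := exists_tri_vec_eq (lam := lam) t 0 (p := (1, 0))
    (q := (0, ell lam (Δ.edge t 0))) (by simp [Hyp.det])
  exact ⟨τ⟩

end IdealTriangle

open IdealTriangle

variable {lam : Δ.Edge → ℝ}

theorem exists_isLift_tri_eq (σ₀ : IdealTriangle lam) (t : T) :
    ∃ σ, IsLift σ₀ σ ∧ σ.tri = t := by
  induction Δ.connected σ₀.tri t with
  | refl => exact ⟨σ₀, .refl, rfl⟩
  | tail _ hbc ih =>
    obtain ⟨σ, hσ, rfl⟩ := ih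
    obtain ⟨i, rfl⟩ := hbc
    obtain ⟨τ, j, hτ⟩ := σ.exists_adjAt i
    exact ⟨τ, hσ.tail ⟨i, hτ.adj⟩, by rw [hτ.1]⟩

theorem IsLift.neg {σ τ : IdealTriangle lam} (h : IsLift σ τ) : IsLift σ.neg τ.neg := by
  induction h with
  | refl => exact .refl
  | tail _ hbc ih =>
    obtain ⟨i, j, hj⟩ := hbc
    exact ih.tail ⟨i, j, AdjAt.neg hj⟩

theorem IsLift.symm_or_neg {σ τ : IdealTriangle lam} (h : IsLift σ τ) :
    IsLift τ σ ∨ IsLift τ σ.neg := by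
  induction h with
  | refl => exact Or.inl .refl
  | @tail b c _ hbc ih =>
    obtain ⟨i, j, hj⟩ := hbc
    have h1 : IsLift c b.neg := .single ⟨j, (AdjAt.symm_neg hj).adj⟩
    rcases ih with h | h
    · exact Or.inr (h1.trans h.neg)
    · have := h.neg
      rw [IdealTriangle.neg_neg] at this
      exact Or.inl (h1.trans this)

theorem IsLift.of_common {σ₀ σ τ : IdealTriangle lam} (h : IsLift σ₀ σ) (h' : IsLift σ₀ τ) :
    IsLift σ τ ∨ IsLift σ τ.neg :=
  h.symm_or_neg.imp (fun h => h.trans h') (fun h => h.trans h'.neg)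

theorem IsLift.exists_reducedPath {σ₀ τ : IdealTriangle lam} (h : IsLift σ₀ τ) :
    ∃ τ' o, EqUpToSign τ' τ ∧ ReducedPath AdjAt σ₀ τ' o := by
  refine ReducedPath.exists_of_reflTransGen eqUpToSign_equivalence ?_ ?_ h
  · rintro x x' i y' j (rfl | rfl) hR
    · exact ⟨y', Or.inl rfl, hR⟩
    · refine ⟨y'.neg, Or.inr y'.neg_neg.symm, ?_⟩
      simpa only [IdealTriangle.neg_neg] using hR.neg
  · intro x i y j z k h1 h2
    exact Or.inr (h1.eq_neg_of_adjAt h2)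

/-- The edges whose opposite angles add up to less than `π`. -/
def essentialEdges (ℓ : Δ.Edge → ℝ) : Set Δ.Edge :=
  {e | Quot.lift (fun d => 0 < cornerCos ℓ d + cornerCos ℓ (Δ.glue d))
    (fun d d' h => by subst h; rw [Δ.glue_glue, add_comm]) e}

theorem edge_mem_essentialEdges {ℓ : Δ.Edge → ℝ} {t : T} {i : Fin 3} :
    Δ.edge t i ∈ essentialEdges ℓ ↔ 0 < cornerCos ℓ (t, i) + cornerCos ℓ (Δ.glue (t, i)) :=
  Iff.rfl

theorem LocallyDelaunay.circumForm_eq_of_sameFace (hL : LocallyDelaunay (ell lam))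
    {σ τ : IdealTriangle lam} (h : SameFace (essentialEdges (ell lam)) σ τ) (w : ℝ × ℝ) :
    τ.circumForm w = σ.circumForm w := by
  induction h with
  | refl => rfl
  | @tail b c _ hbc ih =>
    obtain ⟨i, hi, j, hj⟩ := hbc
    rw [edge_mem_essentialEdges] at hi
    have h0 := le_antisymm (not_lt.1 hi) (hL (b.tri, i))
    have h1 := AdjAt.circumForm_sub hj w
    rw [← hj.1, h0] at h1
    simp at h1
    linarith

/-- Along a reduced path the circumscribed forms decrease on the vectors lying ahead. -/
theorem LocallyDelaunay.circumForm_le_of_reducedPath (hL : LocallyDelaunay (ell lam))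
    {σ τ : IdealTriangle lam} {o : Option (Fin 3)} (h : ReducedPath AdjAt σ τ o) {w : ℝ × ℝ}
    (hw : ∀ j, o = some j → τ.sideProd j w ≤ 0) :
    τ.circumForm w ≤ σ.circumForm w ∧ (σ.circumForm w = τ.circumForm w →
      SameFace (essentialEdges (ell lam)) σ τ ∨
        ∃ τ' k, SameFace (essentialEdges (ell lam)) σ τ' ∧ Hyp.det (τ'.vec k) w = 0) := by
  induction h with
  | base => exact ⟨le_rfl, fun _ => Or.inl .refl⟩
  | @step x o i y j _ ho hxy ih =>
    have h1 : 0 ≤ x.sideProd i w := by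
      have := hw j rfl
      rw [hxy.sideProd_eq] at this
      linarith
    -- As `w` is beyond the exit side `i` and the path does not turn back, `w` is not beyond the
    -- side of entry, so the induction hypothesis applies.
    obtain ⟨ih1, ih2⟩ := ih fun k hk =>
      x.sideProd_nonpos_of_nonneg (fun hki => ho (hk.trans (congrArg some hki))) h1
    have hsub := hxy.circumForm_sub w
    have hcos := hL (x.tri, i)
    rw [hxy.1] at hcos
    have hp := ell_pos lam (Δ.edge x.tri i)
    have hnn : 0 ≤ x.circumForm w - y.circumForm w := by
      rw [hsub]; positivity
    refine ⟨by linarith, fun heq => ?_⟩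
    rcases ih2 (by linarith) with hf | hf
    · by_cases he : Δ.edge x.tri i ∈ essentialEdges (ell lam)
      · right
        rw [edge_mem_essentialEdges, hxy.1] at he
        have hz : x.sideProd i w = 0 := by
          have h0 : x.circumForm w - y.circumForm w = 0 := by linarith
          rw [hsub] at h0
          simpa [hp.ne', he.ne'] using h0
        rcases mul_eq_zero.1 hz with h0 | h0
        · exact ⟨x, _, hf, h0⟩
        · exact ⟨x, _, hf, h0⟩
      · exact Or.inl (hf.tail ⟨i, he, hxy.adj⟩)
    · exact Or.inr hf

theorem IdealTriangle.circumForm_smul (σ : IdealTriangle lam) (m : ℝ) (w : ℝ × ℝ) :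
    σ.circumForm (m • w) = m ^ 2 * σ.circumForm w := by
  unfold circumForm sideForm Hyp.det
  simp only [Prod.smul_fst, Prod.smul_snd, smul_eq_mul]
  ring

theorem IdealTriangle.circumForm_neg (σ : IdealTriangle lam) (w : ℝ × ℝ) :
    σ.circumForm (-w) = σ.circumForm w := by
  have := σ.circumForm_smul (-1) w
  simpa using this

theorem exists_smul_eq_of_det_eq_zero {v w : ℝ × ℝ} (hv : v ≠ 0) (h : Hyp.det v w = 0) :
    ∃ m : ℝ, w = m • v := by
  unfold Hyp.det at h
  by_cases h1 : v.1 = 0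
  · have h2 : v.2 ≠ 0 := fun h2 => hv (Prod.ext h1 h2)
    refine ⟨w.2 / v.2, Prod.ext ?_ ?_⟩
    · have : v.2 * w.1 = 0 := by rw [h1] at h; linarith
      simp [h1, (mul_eq_zero.1 this).resolve_left h2]
    · simp; field_simp
  · refine ⟨w.1 / v.1, Prod.ext ?_ ?_⟩
    · simp; field_simp
    · simp; field_simp; linarith

/-- The form of the last triangle of a reduced path is `1` at its own vectors and does not exceed
that of `σ`. The equality case identifies the horocycles of the face, for which touching rather than
disjointness is required. -/
theorem LocallyDelaunay.one_le_circumForm (hL : LocallyDelaunay (ell lam))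
    {σ τ : IdealTriangle lam} (h : IsLift σ τ) (k : Fin 3) :
    1 ≤ σ.circumForm (τ.vec k) ∧ (σ.circumForm (τ.vec k) = 1 →
      ∃ τ' k', SameFace (essentialEdges (ell lam)) σ τ' ∧
        (τ.vec k = τ'.vec k' ∨ τ.vec k = -τ'.vec k')) := by
  obtain ⟨τ₁, o, hE, hr⟩ := h.exists_reducedPath
  obtain ⟨h1, h2⟩ := hL.circumForm_le_of_reducedPath hr (w := τ₁.vec k)
    (fun j _ => τ₁.sideProd_vec_nonpos j k)
  rw [circumForm_vec] at h1 h2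
  have key : σ.circumForm (τ₁.vec k) = 1 →
      ∃ τ' k', SameFace (essentialEdges (ell lam)) σ τ' ∧
        (τ₁.vec k = τ'.vec k' ∨ τ₁.vec k = -τ'.vec k') := by
    intro heq
    rcases h2 heq with hf | ⟨τ', k', hf, hd⟩
    · exact ⟨τ₁, k, hf, Or.inl rfl⟩
    · obtain ⟨m, hm⟩ := exists_smul_eq_of_det_eq_zero (τ'.vec_ne_zero k') hd
      refine ⟨τ', k', hf, ?_⟩
      rw [hm, circumForm_smul, ← hL.circumForm_eq_of_sameFace hf, circumForm_vec, mul_one] at heq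
      rcases (by simpa using heq : m = 1 ∨ m = -1) with rfl | rfl
      · exact Or.inl (by rw [hm, one_smul])
      · exact Or.inr (by rw [hm, neg_one_smul])
  rcases hE with rfl | rfl
  · exact ⟨h1, key⟩
  · change 1 ≤ σ.circumForm (-τ₁.vec k) ∧ (σ.circumForm (-τ₁.vec k) = 1 →
      ∃ (τ' : IdealTriangle lam) (k' : Fin 3), _ ∧ (-τ₁.vec k = τ'.vec k' ∨ -τ₁.vec k = -τ'.vec k'))
    rw [circumForm_neg]
    refine ⟨h1, fun heq => ?_⟩
    obtain ⟨τ', k', hf, h3 | h3⟩ := key heq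
    · exact ⟨τ', k', hf, Or.inr (by rw [h3])⟩
    · exact ⟨τ', k', hf, Or.inl (by rw [h3, _root_.neg_neg])⟩

end Triangulation

/-! ## Disjoint cusp neighborhoods -/

namespace Triangulation

variable {T : Type*} {Δ : Triangulation T} {lam : Δ.Edge → ℝ}

open IdealTriangle

theorem exists_ell_bounds [Finite T] (lam : Δ.Edge → ℝ) :
    ∃ a L : ℝ, 0 < a ∧ 0 < L ∧ ∀ e, a ≤ ell lam e ∧ ell lam e ≤ L := by
  have : Finite Δ.Edge := Finite.of_surjective (Quot.mk _) Quot.mk_surjective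
  obtain ⟨m, hm⟩ := (Set.finite_range lam).bddBelow
  obtain ⟨M, hM⟩ := (Set.finite_range lam).bddAbove
  refine ⟨Real.exp (m / 2), Real.exp (M / 2), Real.exp_pos _, Real.exp_pos _, fun e => ?_⟩
  have h1 := hm (Set.mem_range_self e)
  have h2 := hM (Set.mem_range_self e)
  exact ⟨Real.exp_le_exp.2 (by linarith), Real.exp_le_exp.2 (by linarith)⟩

/-- The center of the horocycle encoded by `u`, in a coordinate placing the center of the
horocycle encoded by `v` at infinity. -/
noncomputable def slope (v g u : ℝ × ℝ) : ℝ := Hyp.det g u / Hyp.det v u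

theorem slope_neg (v g u : ℝ × ℝ) : slope v g (-u) = slope v g u := by
  have h : ∀ a : ℝ × ℝ, Hyp.det a (-u) = -Hyp.det a u := by
    intro a; simp [Hyp.det]; ring
  rw [slope, h, h, neg_div_neg_eq, slope]

/-- With the cusp at infinity the opposite side spans this length on the real line, by the identity
between the determinants of `g, v` and the two vectors of that side. -/
theorem slope_vec_add_two (σ : IdealTriangle lam) {k : Fin 3} {v g : ℝ × ℝ}
    (hg : Hyp.det g v = 1) (hv : σ.vec k = v ∨ σ.vec k = -v) :
    slope v g (σ.vec (k + 2)) = slope v g (σ.vec (k + 1)) +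
      ell lam (Δ.edge σ.tri k) /
        (ell lam (Δ.edge σ.tri (k + 1)) * ell lam (Δ.edge σ.tri (k + 2))) := by
  have h0 := σ.det_eq k
  have h1 := σ.det_vec_add_one k
  have h2 := σ.det_vec_add_two k
  have p1 := ell_pos lam (Δ.edge σ.tri (k + 1))
  have p2 := ell_pos lam (Δ.edge σ.tri (k + 2))
  have hid : Hyp.det g (σ.vec (k + 1)) * Hyp.det v (σ.vec (k + 2)) -
      Hyp.det g (σ.vec (k + 2)) * Hyp.det v (σ.vec (k + 1)) = ell lam (Δ.edge σ.tri k) := by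
    rw [← h0, ← one_mul (Hyp.det (σ.vec (k + 1)) _), ← hg]
    unfold Hyp.det
    ring
  unfold slope
  rcases hv with hv | hv
  · have e1 : Hyp.det v (σ.vec (k + 1)) = ell lam (Δ.edge σ.tri (k + 2)) := by rw [← h1, hv]
    have e2 : Hyp.det v (σ.vec (k + 2)) = -ell lam (Δ.edge σ.tri (k + 1)) := by
      rw [← h2, hv]; unfold Hyp.det; ring
    rw [e1, e2] at hid ⊢
    field_simp
    linarith
  · have e1 : Hyp.det v (σ.vec (k + 1)) = -ell lam (Δ.edge σ.tri (k + 2)) := by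
      rw [← h1, hv]; simp [Hyp.det]; ring
    have e2 : Hyp.det v (σ.vec (k + 2)) = ell lam (Δ.edge σ.tri (k + 1)) := by
      rw [← h2, hv]; simp [Hyp.det]; ring
    rw [e1, e2] at hid ⊢
    field_simp
    linarith

/-- Rotating about a cusp one comes close to every slope. -/
theorem exists_slope_near {a L : ℝ} (ha : 0 < a) (hL : 0 < L)
    (hb : ∀ e, a ≤ ell lam e ∧ ell lam e ≤ L) {v g : ℝ × ℝ} (hg : Hyp.det g v = 1) (m : ℝ)
    {σ : IdealTriangle lam} {k : Fin 3} (hv : σ.vec k = v ∨ σ.vec k = -v) :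
    ∃ τ k', IsLift σ τ ∧ (τ.vec k' = v ∨ τ.vec k' = -v) ∧
      |m - slope v g (τ.vec (k' + 1))| ≤ L / a ^ 2 := by
  have hδ : 0 < a / L ^ 2 := by positivity
  have hstep : ∀ (τ : IdealTriangle lam) (k' : Fin 3),
      a / L ^ 2 ≤ ell lam (Δ.edge τ.tri k') /
        (ell lam (Δ.edge τ.tri (k' + 1)) * ell lam (Δ.edge τ.tri (k' + 2))) ∧
      ell lam (Δ.edge τ.tri k') /
        (ell lam (Δ.edge τ.tri (k' + 1)) * ell lam (Δ.edge τ.tri (k' + 2))) ≤ L / a ^ 2 := by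
    intro τ k'
    have p0 := hb (Δ.edge τ.tri k')
    have p1 := hb (Δ.edge τ.tri (k' + 1))
    have p2 := hb (Δ.edge τ.tri (k' + 2))
    generalize ell lam (Δ.edge τ.tri k') = x at *
    generalize ell lam (Δ.edge τ.tri (k' + 1)) = y at *
    generalize ell lam (Δ.edge τ.tri (k' + 2)) = z at *
    have hy : 0 < y := ha.trans_le p1.1
    have hz : 0 < z := ha.trans_le p2.1
    constructor
    · apply div_le_div₀ (ha.le.trans p0.1) p0.1 (by positivity)
      rw [sq]
      exact mul_le_mul p1.2 p2.2 hz.le hL.le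
    · apply div_le_div₀ hL.le p0.2 (by positivity)
      rw [sq]
      exact mul_le_mul p1.1 p2.1 ha.le hy.le
  -- Each rotation moves the slope by at least `a / L ^ 2` and at most `L / a ^ 2`. Thus the excess
  -- over `L / a ^ 2` shrinks by a fixed amount without overshooting, and `n` counts the steps still
  -- allowed.
  have main : ∀ (n : ℕ) (τ : IdealTriangle lam) (k' : Fin 3), IsLift σ τ →
      (τ.vec k' = v ∨ τ.vec k' = -v) →
      |m - slope v g (τ.vec (k' + 1))| ≤ L / a ^ 2 + n * (a / L ^ 2) →
      ∃ τ k', IsLift σ τ ∧ (τ.vec k' = v ∨ τ.vec k' = -v) ∧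
        |m - slope v g (τ.vec (k' + 1))| ≤ L / a ^ 2 := by
    intro n
    induction n with
    | zero => exact fun τ k' h1 h2 h3 => ⟨τ, k', h1, h2, by simpa using h3⟩
    | succ n ih =>
      intro τ k' h1 h2 h3
      obtain ⟨e1, e2, e3, e4⟩ := fin_three_add k'
      push_cast at h3
      have hLa : 0 ≤ L / a ^ 2 := by positivity
      have hn : 0 ≤ n * (a / L ^ 2) := by positivity
      rw [abs_le] at h3
      by_cases hpos : L / a ^ 2 < m - slope v g (τ.vec (k' + 1))
      · obtain ⟨ρ, j, hρ⟩ := τ.exists_adjAt (k' + 1)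
        obtain ⟨f1, f2, -, -⟩ := fin_three_add j
        have hs := slope_vec_add_two τ hg h2
        have hb' := hstep τ k'
        have r1 := hρ.2.1
        have r2 := hρ.2.2
        rw [e2] at r1
        rw [e1] at r2
        refine ih ρ (j + 1) (h1.tail ⟨_, hρ.adj⟩) (by rw [r1]; exact h2) ?_
        rw [f1, r2, slope_neg, hs, abs_le]
        constructor <;> linarith [h3.1, h3.2, hb'.1, hb'.2]
      · by_cases hneg : m - slope v g (τ.vec (k' + 1)) < -(L / a ^ 2)
        · obtain ⟨ρ, j, hρ⟩ := τ.exists_adjAt (k' + 2)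
          obtain ⟨-, -, f3, f4⟩ := fin_three_add j
          have r1 := hρ.2.1
          have r2 := hρ.2.2
          rw [e4] at r1
          rw [e3] at r2
          have h2' : ρ.vec (j + 2) = v ∨ ρ.vec (j + 2) = -v := by
            rw [r2]
            rcases h2 with h2 | h2
            · exact Or.inr (by rw [h2])
            · exact Or.inl (by rw [h2, _root_.neg_neg])
          have hs := slope_vec_add_two ρ hg h2'
          have hb' := hstep ρ (j + 2)
          rw [f4, r1] at hs
          rw [f4] at hb'
          refine ih ρ (j + 2) (h1.tail ⟨_, hρ.adj⟩) h2' ?_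
          rw [abs_le]
          constructor <;> linarith [h3.1, h3.2, hb'.1, hb'.2]
        · exact ⟨τ, k', h1, h2, abs_le.2 ⟨not_lt.1 hneg, not_lt.1 hpos⟩⟩
  obtain ⟨n, hn⟩ := exists_nat_ge (|m - slope v g (σ.vec (k + 1))| / (a / L ^ 2))
  rw [div_le_iff₀ hδ] at hn
  have hLa : 0 ≤ L / a ^ 2 := by positivity
  exact main n σ k .refl hv (by linarith)

/-- Rotate about the cusp of `v` to a triangle with a vertex `u` whose slope is close to that of
`w`; then `|det u w|` is bounded by a constant times `|det v w|`. As the form of that triangle is at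
least `1` at `w` and its cosine is at most `1` in absolute value, the side joining `v` and `u` is at
most `|det v w| + |det u w|`. -/
theorem LocallyDelaunay.le_abs_det (hD : LocallyDelaunay (ell lam))
    (hT : TriangleInequalities (ell lam)) {a L : ℝ} (ha : 0 < a) (hL : 0 < L)
    (hb : ∀ e, a ≤ ell lam e ∧ ell lam e ≤ L) {σ τ : IdealTriangle lam} (h : IsLift σ τ)
    (k k' : Fin 3) (hne : Hyp.det (σ.vec k) (τ.vec k') ≠ 0) :
    a / (1 + L / a ^ 2 * L) ≤ |Hyp.det (σ.vec k) (τ.vec k')| := by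
  obtain ⟨v, hv⟩ : ∃ v, v = σ.vec k := ⟨_, rfl⟩
  obtain ⟨w, hw⟩ : ∃ w, w = τ.vec k' := ⟨_, rfl⟩
  have hv0 : v ≠ 0 := hv ▸ σ.vec_ne_zero k
  rw [← hv, ← hw] at hne ⊢
  obtain ⟨g, hg⟩ : ∃ g, Hyp.det g v = 1 := by
    by_cases h1 : v.1 = 0
    · have h2 : v.2 ≠ 0 := fun h2 => hv0 (Prod.ext h1 h2)
      exact ⟨(1 / v.2, 0), by simp [Hyp.det, h2]⟩
    · exact ⟨(0, -(1 / v.1)), by simp [Hyp.det, h1]⟩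
  obtain ⟨ρ, i, hρ, hi, hm⟩ := exists_slope_near ha hL hb hg (slope v g w) (Or.inl hv.symm)
  obtain ⟨e1, e2, e3, e4⟩ := fin_three_add i
  have hone : 1 ≤ ρ.circumForm w := by
    rcases hρ.of_common h with h | h
    · rw [hw]; exact (hD.one_le_circumForm h k').1
    · rw [hw, ← circumForm_neg]; exact (hD.one_le_circumForm h k').1
  rw [ρ.circumForm_eq_sideForm (i + 2), sideForm, e3, e4] at hone
  have hcos := hT.sq_cornerCos_lt_one (ell_pos lam) (ρ.tri, i + 2)
  have hu : |Hyp.det v (ρ.vec (i + 1))| = ell lam (Δ.edge ρ.tri (i + 2)) := by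
    rw [← abs_of_pos (ell_pos lam (Δ.edge ρ.tri (i + 2))), ← ρ.det_vec_add_one]
    rcases hi with hi | hi
    · rw [hi]
    · rw [hi, ← abs_neg]; congr 1; simp [Hyp.det]; ring
  have hbd := hb (Δ.edge ρ.tri (i + 2))
  set e := ell lam (Δ.edge ρ.tri (i + 2)) with he
  have he0 : 0 < e := ha.trans_le hbd.1
  set u := ρ.vec (i + 1) with hudef
  have hdi : |Hyp.det (ρ.vec i) w| = |Hyp.det v w| := by
    rcases hi with hi | hi
    · rw [hi]
    · rw [hi, ← abs_neg]; congr 1; simp [Hyp.det]; ring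
  have hvu0 : Hyp.det v u ≠ 0 := by
    intro h0
    rw [h0, abs_zero] at hu
    linarith
  have hduw : Hyp.det u w = -(slope v g w - slope v g u) * (Hyp.det v u * Hyp.det v w) := by
    have : (slope v g w - slope v g u) * (Hyp.det v u * Hyp.det v w) =
        Hyp.det g w * Hyp.det v u - Hyp.det g u * Hyp.det v w := by
      unfold slope; field_simp
    rw [neg_mul, this, ← one_mul (Hyp.det u w), ← hg]
    unfold Hyp.det; ring
  have hduw' : |Hyp.det u w| ≤ L / a ^ 2 * L * |Hyp.det v w| := by
    rw [hduw, abs_mul, abs_neg, abs_mul, hu, ← mul_assoc]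
    exact mul_le_mul_of_nonneg_right (mul_le_mul hm hbd.2 he0.le (by positivity)) (abs_nonneg _)
  generalize cornerCos (ell lam) (ρ.tri, i + 2) = q at *
  rw [le_div_iff₀ (by positivity), one_mul] at hone
  have hsum : e ^ 2 ≤ (|Hyp.det (ρ.vec i) w| + |Hyp.det u w|) ^ 2 := by
    have hq : |q| ≤ 1 := (sq_lt_one_iff_abs_lt_one q).1 hcos |>.le
    have h1 : q * Hyp.det (ρ.vec i) w * Hyp.det u w ≤
        |Hyp.det (ρ.vec i) w| * |Hyp.det u w| := by
      refine (le_abs_self _).trans ?_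
      rw [abs_mul, abs_mul, mul_assoc]
      exact mul_le_of_le_one_left (by positivity) hq
    nlinarith [sq_abs (Hyp.det (ρ.vec i) w), sq_abs (Hyp.det u w)]
  have hsum' := abs_le_of_sq_le_sq' hsum (by positivity) |>.2
  rw [hdi] at hsum'
  rw [div_le_iff₀ (by positivity)]
  linarith [hbd.1]

/-- The ideal Delaunay property follows from the local Delaunay condition. -/
theorem LocallyDelaunay.isIdealDelaunay [Finite T] [Nonempty T] (hD : LocallyDelaunay (ell lam))
    (hT : TriangleInequalities (ell lam)) : IsIdealDelaunay lam := by
  obtain ⟨a, L, ha, hL, hb⟩ := exists_ell_bounds lam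
  obtain ⟨σ₀⟩ := nonempty_of_nonempty (lam := lam)
  set δ := a / (1 + L / a ^ 2 * L) with hδ
  have hδ0 : 0 < δ := by positivity
  -- `exp (-s) ≤ δ` makes the horodisks disjoint, and `exp (-s) < a ≤ ρ` makes the radius `log ρ +
  -- s` positive.
  obtain ⟨s, hs0, hsa, hsδ⟩ : ∃ s : ℝ, 0 ≤ s ∧ Real.exp (-s) < a ∧ Real.exp (-s) ≤ δ := by
    refine ⟨max 0 (max (1 - Real.log a) (-Real.log δ)), le_max_left _ _, ?_, ?_⟩
    · rw [← Real.lt_log_iff_exp_lt ha]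
      have := (le_max_left (1 - Real.log a) (-Real.log δ)).trans
        (le_max_right 0 (max (1 - Real.log a) (-Real.log δ)))
      linarith
    · rw [← Real.le_log_iff_exp_le hδ0]
      have := (le_max_right (1 - Real.log a) (-Real.log δ)).trans
        (le_max_right 0 (max (1 - Real.log a) (-Real.log δ)))
      linarith
  refine ⟨essentialEdges (ell lam), σ₀, s, hs0, ?_, ?_⟩
  · intro σ k σ' k' hσ hσ' hne
    refine Hyp.disjoint_horodisk (σ.vec_ne_zero k) (σ'.vec_ne_zero k') (hsδ.trans ?_)
    have key : ∀ {σ τ : IdealTriangle lam} (k' : Fin 3), IsLift σ₀ σ → IsLift σ₀ τ →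
        1 ≤ σ.circumForm (τ.vec k') := by
      intro σ τ k' h h'
      rcases h.of_common h' with h | h
      · exact (hD.one_le_circumForm h k').1
      · rw [← circumForm_neg]; exact (hD.one_le_circumForm h k').1
    -- If the vectors were parallel with ratio `m`, the bound `1 ≤ circumForm` in both directions
    -- would give `m ^ 2 = 1`, hence equal horocycles.
    have hne0 : Hyp.det (σ.vec k) (σ'.vec k') ≠ 0 := by
      intro h0
      obtain ⟨m, hm⟩ := exists_smul_eq_of_det_eq_zero (σ.vec_ne_zero k) h0
      have h1 := key k' hσ hσ'
      rw [hm, circumForm_smul, circumForm_vec, mul_one] at h1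
      have h2 := key k hσ' hσ
      have h3 := σ'.circumForm_vec k'
      rw [hm, circumForm_smul] at h3
      have h4 : m ^ 2 = 1 := by nlinarith
      apply hne
      rcases (by simpa using h4 : m = 1 ∨ m = -1) with rfl | rfl
      · rw [hm, one_smul]
      · rw [hm, neg_one_smul, Hyp.horocycle_neg]
    rcases hσ.of_common hσ' with h | h
    · exact hD.le_abs_det hT ha hL hb h k k' hne0
    · have e : |Hyp.det (σ.vec k) (σ'.neg.vec k')| = |Hyp.det (σ.vec k) (σ'.vec k')| := by
        rw [← abs_neg]; congr 1; simp [Hyp.det, IdealTriangle.neg]; ring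
      rw [← e]
      refine hD.le_abs_det hT ha hL hb h k k' ?_
      rwa [← abs_ne_zero, e, abs_ne_zero]
  · intro σ hσ
    obtain ⟨c, ρ, hρ, hform, hle⟩ := σ.exists_horoForm_eq hT
    have hρs : Real.exp (-s) < ρ := hsa.trans_le ((hb _).1.trans (hle 0))
    have hr : 0 < Real.log ρ + s := by
      have := (Real.lt_log_iff_exp_lt hρ).2 hρs
      linarith
    refine ⟨c, Real.log ρ + s, hr, fun τ k hτ => ?_, ?_⟩
    · refine Hyp.touchesExternally_of_signedDist_eq (τ.vec_ne_zero k) hr.le ?_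
      rw [Hyp.signedDist_eq_log_horoForm, hform, ← hD.circumForm_eq_of_sameFace hτ,
        circumForm_vec, mul_one]
      ring
    · rintro h ⟨τ, k, hτ, rfl⟩ hnot
      obtain ⟨τ', hτ', hτe⟩ : ∃ τ', IsLift σ τ' ∧ (τ'.vec k = τ.vec k ∨ τ'.vec k = -τ.vec k) := by
        rcases hσ.of_common hτ with h | h
        · exact ⟨τ, h, Or.inl rfl⟩
        · exact ⟨τ.neg, h, Or.inr rfl⟩
      have hhor : Hyp.horocycle (τ.vec k) s = Hyp.horocycle (τ'.vec k) s := by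
        rcases hτe with h | h
        · rw [h]
        · rw [h, Hyp.horocycle_neg]
      rw [hhor] at hnot ⊢
      obtain ⟨h1, h2⟩ := hD.one_le_circumForm hτ' k
      have h3 : 1 < σ.circumForm (τ'.vec k) := by
        refine lt_of_le_of_ne h1 fun heq => hnot ?_
        obtain ⟨τ₂, k₂, hf, h4 | h4⟩ := h2 heq.symm
        · exact ⟨τ₂, k₂, hf, by rw [h4]⟩
        · exact ⟨τ₂, k₂, hf, by rw [h4, Hyp.horocycle_neg]⟩
      refine Hyp.disjoint_sphere_horocycle (τ'.vec_ne_zero k) ?_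
      rw [Hyp.signedDist_eq_log_horoForm, hform, add_sub_cancel_right]
      exact Real.log_lt_log hρ (by nlinarith)

/-- Conversely, the ideal Delaunay property implies the triangle inequalities and the local
Delaunay condition. -/
theorem IsIdealDelaunay.locallyDelaunay (h : IsIdealDelaunay lam) :
    TriangleInequalities (ell lam) ∧ LocallyDelaunay (ell lam) := by
  obtain ⟨D, σ₀, s, hs, hdisj, hglob⟩ := h
  have key : ∀ σ, IsLift σ₀ σ → (∀ i, cornerCos (ell lam) (σ.tri, i) ^ 2 < 1) ∧
      ∀ τ k, IsLift σ₀ τ → 1 ≤ σ.circumForm (τ.vec k) := by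
    intro σ hσ
    obtain ⟨c, r, hr, htouch, hout⟩ := hglob σ hσ
    have hsd : ∀ τ k, SameFace D σ τ → Hyp.signedDist (τ.vec k) c = r - s := fun τ k hτ =>
      (htouch τ k hτ).signedDist_eq (τ.vec_ne_zero k) hr
    have hρ : ∀ k, Hyp.horoForm c (σ.vec k) = Real.exp (r - s) := by
      intro k
      rw [← hsd σ k .refl, Hyp.signedDist_eq_log_horoForm,
        Real.exp_log (Hyp.horoForm_pos c (σ.vec_ne_zero k))]
    obtain ⟨hform, hcos⟩ := σ.horoForm_eq_of_const (Real.exp_pos _) hρ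
    refine ⟨hcos, fun τ k hτ => ?_⟩
    have hτ0 := τ.vec_ne_zero k
    have hle : r - s ≤ Hyp.signedDist (τ.vec k) c := by
      by_cases hface : Hyp.horocycle (τ.vec k) s ∈ faceHorocycles D σ s
      · obtain ⟨τ', k', hτ', heq⟩ := hface
        rw [Hyp.signedDist_eq_of_horocycle_eq hτ0 heq (τ'.vec_ne_zero k'), hsd τ' k' hτ']
      · rcases Hyp.signedDist_of_disjoint_sphere hτ0 (hout _ ⟨τ, k, hτ, rfl⟩ hface) with h | h
        · exact h.le
        · have hne : Hyp.horocycle (σ.vec 0) s ≠ Hyp.horocycle (τ.vec k) s := fun heq =>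
            hface ⟨σ, 0, .refl, heq.symm⟩
          have := Hyp.le_signedDist_of_disjoint_horodisk (σ.vec_ne_zero 0) hτ0 hr.le
            (hsd σ 0 .refl) (hdisj σ 0 τ k hσ hτ hne)
          linarith
    rw [Hyp.signedDist_eq_log_horoForm, Real.le_log_iff_exp_le (Hyp.horoForm_pos c hτ0),
      hform] at hle
    exact (le_mul_iff_one_le_right (Real.exp_pos _)).1 hle
  constructor
  · refine triangleInequalities_of_sq_cornerCos_lt_one (ell_pos lam) ?_
    rintro ⟨t, i⟩
    obtain ⟨σ, hσ, rfl⟩ := exists_isLift_tri_eq σ₀ t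
    exact (key σ hσ).1 i
  · rintro ⟨t, i⟩
    obtain ⟨σ, hσ, rfl⟩ := exists_isLift_tri_eq σ₀ t
    obtain ⟨τ, j, hτ⟩ := σ.exists_adjAt i
    -- At the apex of the neighbor, its own form is `1` and that of `σ` is at least `1`, while the
    -- side product is positive, so the cosine sum cannot be negative.
    have h1 := (key σ hσ).2 τ j (hσ.tail ⟨i, hτ.adj⟩)
    have h2 := hτ.circumForm_sub (τ.vec j)
    rw [circumForm_vec] at h2
    have h3 : 0 < σ.sideProd i (τ.vec j) := by
      have := τ.sideProd_vec_neg j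
      rw [hτ.sideProd_eq] at this
      linarith
    have hp := ell_pos lam (Δ.edge σ.tri i)
    rw [hτ.1]
    by_contra! hneg
    have h4 : 2 * (cornerCos (ell lam) (σ.tri, i) + cornerCos (ell lam) (τ.tri, j)) *
        σ.sideProd i (τ.vec j) / ell lam (Δ.edge σ.tri i) ^ 2 < 0 :=
      div_neg_of_neg_of_pos (mul_neg_of_neg_of_pos (by linarith) h3) (by positivity)
    linarith

end Triangulation

/-! ## Triangles in the euclidean plane -/

namespace Euc

/-- Twice the signed area of the triangle `p, q, x`. -/
def orient (p q x : ℂ) : ℝ := (q.re - p.re) * (x.im - p.im) - (q.im - p.im) * (x.re - p.re)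

/-- The power of the point `x` with respect to the circle with center `c` and radius `r`. -/
def power (c : ℂ) (r : ℝ) (x : ℂ) : ℝ := (x.re - c.re) ^ 2 + (x.im - c.im) ^ 2 - r ^ 2

/-- The scalar product of `a - x` and `b - x`. -/
def dot (a b x : ℂ) : ℝ := (a.re - x.re) * (b.re - x.re) + (a.im - x.im) * (b.im - x.im)

theorem dist_sq (z w : ℂ) : dist z w ^ 2 = (z.re - w.re) ^ 2 + (z.im - w.im) ^ 2 := by
  rw [Complex.dist_eq, ← Complex.normSq_eq_norm_sq, Complex.normSq_apply, Complex.sub_re,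
    Complex.sub_im]
  ring

theorem power_eq_zero {c x : ℂ} {r : ℝ} (h : dist x c = r) : power c r x = 0 := by
  unfold power
  rw [← dist_sq, h, sub_self]

theorem mem_ball_iff_power_neg {c x : ℂ} {r : ℝ} (hr : 0 ≤ r) :
    x ∈ Metric.ball c r ↔ power c r x < 0 := by
  unfold power
  rw [Metric.mem_ball, ← dist_sq, sub_neg, sq_lt_sq₀ dist_nonneg hr]

/-- An affine function vanishing at `a` and `b` is proportional to `orient a b`. -/
theorem affine_mul_orient {α β γ : ℝ} {a b : ℂ} (ha : α * a.re + β * a.im + γ = 0)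
    (hb : α * b.re + β * b.im + γ = 0) (x q : ℂ) :
    (α * x.re + β * x.im + γ) * orient a b q = (α * q.re + β * q.im + γ) * orient a b x := by
  have h : (α * x.re + β * x.im + γ) * orient a b q - (α * q.re + β * q.im + γ) * orient a b x =
      (α * b.re + β * b.im + γ) * orient a x q - (α * a.re + β * a.im + γ) * orient b x q := by
    unfold orient; ring
  rw [ha, hb] at h
  linarith

/-- Two circles through `a` and `b`. -/
theorem power_sub_power_mul_orient {c c' a b : ℂ} {r r' : ℝ} (ha : dist a c = r)
    (hb : dist b c = r) (ha' : dist a c' = r') (hb' : dist b c' = r') (x q : ℂ) :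
    (power c r x - power c' r' x) * orient a b q =
      (power c r q - power c' r' q) * orient a b x := by
  have key : ∀ x, power c r x - power c' r' x = 2 * (c'.re - c.re) * x.re +
      2 * (c'.im - c.im) * x.im + (c.re ^ 2 + c.im ^ 2 - r ^ 2 - c'.re ^ 2 - c'.im ^ 2 + r' ^ 2) := by
    intro x; unfold power; ring
  rw [key, key]
  apply affine_mul_orient
  · rw [← key, power_eq_zero ha, power_eq_zero ha', sub_self]
  · rw [← key, power_eq_zero hb, power_eq_zero hb', sub_self]

/-- The power of a point with respect to the circumcircle of `a, b, p`. -/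
theorem power_mul_orient {c a b p : ℂ} {r : ℝ} (ha : dist a c = r) (hb : dist b c = r)
    (hp : dist p c = r) (q : ℂ) :
    power c r q * orient a b p = dot a b q * orient a b p + dot a b p * orient b a q := by
  -- The circle with diameter `ab` has power `dot a b`, so the difference is affine and vanishes at
  -- `a` and `b`.
  have key : ∀ x, power c r x - dot a b x = (a.re + b.re - 2 * c.re) * x.re +
      (a.im + b.im - 2 * c.im) * x.im +
        (c.re ^ 2 + c.im ^ 2 - r ^ 2 - a.re * b.re - a.im * b.im) := by
    intro x; unfold power dot; ring
  have h := affine_mul_orient (α := a.re + b.re - 2 * c.re) (β := a.im + b.im - 2 * c.im)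
    (γ := c.re ^ 2 + c.im ^ 2 - r ^ 2 - a.re * b.re - a.im * b.im) (a := a) (b := b)
    (by rw [← key, power_eq_zero ha]; unfold dot; ring)
    (by rw [← key, power_eq_zero hb]; unfold dot; ring) q p
  rw [← key, ← key, power_eq_zero hp] at h
  have h' : orient b a q = -orient a b q := by unfold orient; ring
  rw [h']
  linear_combination h

theorem exists_circumcenter {a b p : ℂ} (h : orient a b p ≠ 0) :
    ∃ (c : ℂ) (r : ℝ), dist a c = r ∧ dist b c = r ∧ dist p c = r := by
  obtain ⟨c, h1, h2⟩ : ∃ c : ℂ, dist b c = dist a c ∧ dist p c = dist a c := by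
    refine ⟨⟨a.re + ((p.im - a.im) * ((b.re - a.re) ^ 2 + (b.im - a.im) ^ 2) -
      (b.im - a.im) * ((p.re - a.re) ^ 2 + (p.im - a.im) ^ 2)) / (2 * orient a b p),
      a.im + ((b.re - a.re) * ((p.re - a.re) ^ 2 + (p.im - a.im) ^ 2) -
      (p.re - a.re) * ((b.re - a.re) ^ 2 + (b.im - a.im) ^ 2)) / (2 * orient a b p)⟩, ?_, ?_⟩
    all_goals
      rw [← sq_eq_sq₀ dist_nonneg dist_nonneg, dist_sq, dist_sq]
      field_simp
      unfold orient
      ring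
  exact ⟨c, dist a c, rfl, h1, h2⟩

/-- For angles `α, β` in `(0, π)` this is `(cos α + cos β) * (sin α + sin β) = sin (α + β) * (1 +
cos (α - β))`, whose other factors are positive. -/
theorem sin_add_nonneg_iff {S C S' C' : ℝ} (hS : 0 < S) (hS' : 0 < S') (h : S ^ 2 + C ^ 2 = 1)
    (h' : S' ^ 2 + C' ^ 2 = 1) : 0 ≤ S * C' + S' * C ↔ 0 ≤ C + C' := by
  have h1 : (C + C') * (S + S') = (S * C' + S' * C) * (1 + C * C' + S * S') := by
    linear_combination (-S' * C') * h - S * C * h'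
  have h2 : 0 < 1 + C * C' + S * S' := by nlinarith [mul_pos hS hS', sq_nonneg (C + C')]
  have h3 : 0 < S + S' := by linarith
  constructor
  · intro h
    have := mul_nonneg h h2.le
    rw [← h1] at this
    exact nonneg_of_mul_nonneg_left this h3
  · intro h
    have := mul_nonneg h h3.le
    rw [h1] at this
    exact nonneg_of_mul_nonneg_left this h2

/-- A disk that does not contain the vertex `m` of a triangle but meets both sides at `m` contains
no point of the sector vertically opposite to the triangle. -/
theorem not_mem_ball_of_orient_nonpos {i k m y z w c : ℂ} {r : ℝ} (ho : 0 < orient i k m)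
    (hm : m ∉ Metric.ball c r) (hy : y ∈ segment ℝ m i) (hyB : y ∈ Metric.ball c r)
    (hz : z ∈ segment ℝ k m) (hzB : z ∈ Metric.ball c r) (h1 : orient k m w ≤ 0)
    (h2 : orient m i w ≤ 0) : w ∉ Metric.ball c r := by
  intro hwB
  rw [segment_symm] at hz
  rw [segment_eq_image'] at hy hz
  obtain ⟨s, ⟨hs0, -⟩, rfl⟩ := hy
  obtain ⟨t, ⟨ht0, -⟩, rfl⟩ := hz
  have hs : 0 < s := hs0.lt_of_ne fun h => hm (by simpa [← h] using hyB)
  have ht : 0 < t := ht0.lt_of_ne fun h => hm (by simpa [← h] using hzB)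
  set A := orient i k m with hA
  -- In the opposite sector `w - m` is a nonpositive combination of `i - m` and `k - m`. So `m` is
  -- the mean of `w`, `y`, `z` with weights `1, P, Q`, and convexity would put it in the disk.
  set P := -orient k m w / (A * s) with hP
  set Q := -orient m i w / (A * t) with hQ
  have hP0 : 0 ≤ P := div_nonneg (by linarith) (by positivity)
  have hQ0 : 0 ≤ Q := div_nonneg (by linarith) (by positivity)
  have hid : ((1 + P + Q : ℝ) : ℂ) * (m - c) =
      (w - c) + P * (m + s • (i - m) - c) + Q * (m + t • (k - m) - c) := by
    have hPs : P * s = -orient k m w / A := by rw [hP]; field_simp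
    have hQt : Q * t = -orient m i w / A := by rw [hQ]; field_simp
    have hbary : w - m = ((orient k m w / A : ℝ) : ℂ) * (i - m) +
        ((orient m i w / A : ℝ) : ℂ) * (k - m) := by
      apply Complex.ext
      · simp
        field_simp
        rw [hA]; unfold orient; ring
      · simp
        field_simp
        rw [hA]; unfold orient; ring
    have hPs' : (P : ℂ) * s = -((orient k m w / A : ℝ) : ℂ) := by
      rw [← Complex.ofReal_mul, hPs, neg_div, Complex.ofReal_neg]
    have hQt' : (Q : ℂ) * t = -((orient m i w / A : ℝ) : ℂ) := by
      rw [← Complex.ofReal_mul, hQt, neg_div, Complex.ofReal_neg]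
    simp only [Complex.real_smul]
    push_cast at *
    linear_combination -hbary - (i - m) * hPs' - (k - m) * hQt'
  rw [Metric.mem_ball, Complex.dist_eq] at hyB hzB hwB
  apply hm
  rw [Metric.mem_ball, Complex.dist_eq]
  have hn := congrArg norm hid
  rw [norm_mul, Complex.norm_real, Real.norm_of_nonneg (by positivity)] at hn
  have h3 := norm_add₃_le (a := w - c) (b := P * (m + s • (i - m) - c))
    (c := Q * (m + t • (k - m) - c))
  rw [norm_mul, norm_mul, Complex.norm_real, Complex.norm_real, Real.norm_of_nonneg hP0,
    Real.norm_of_nonneg hQ0] at h3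
  have h4 := mul_le_mul_of_nonneg_left hyB.le hP0
  have h5 := mul_le_mul_of_nonneg_left hzB.le hQ0
  have h6 : (1 + P + Q) * ‖m - c‖ < (1 + P + Q) * r := by linarith
  exact lt_of_mul_lt_mul_left h6 (by positivity)

theorem eq_of_dist_eq_of_orient_pos {a b p p' : ℂ} (ha : dist a p = dist a p')
    (hb : dist b p = dist b p') (h : 0 < orient a b p) (h' : 0 < orient a b p') : p = p' := by
  have ha2 := congrArg (· ^ 2) ha
  have hb2 := congrArg (· ^ 2) hb
  simp only [dist_sq] at ha2 hb2
  set d := b - a with hd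
  have hdr : d.re = b.re - a.re := by simp [hd]
  have hdi : d.im = b.im - a.im := by simp [hd]
  have hdot : d.re * (p.re - p'.re) + d.im * (p.im - p'.im) = 0 := by
    rw [hdr, hdi]; linear_combination (ha2 - hb2) / 2
  have hN : d.re ^ 2 + d.im ^ 2 ≠ 0 := by
    intro h0
    have h1 : d.re = 0 := by nlinarith [sq_nonneg d.re, sq_nonneg d.im]
    have h2 : d.im = 0 := by nlinarith [sq_nonneg d.re, sq_nonneg d.im]
    unfold orient at h
    rw [← hdr, ← hdi, h1, h2] at h
    simp at h
  have hsq : orient a b p ^ 2 = orient a b p' ^ 2 := by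
    unfold orient
    rw [← hdr, ← hdi]
    linear_combination (d.re ^ 2 + d.im ^ 2) * ha2 -
      (d.re * (p.re - a.re) + d.im * (p.im - a.im) +
        d.re * (p'.re - a.re) + d.im * (p'.im - a.im)) * hdot
  have ho : orient a b p = orient a b p' := by
    rwa [sq_eq_sq₀ h.le h'.le] at hsq
  unfold orient at ho
  rw [← hdr, ← hdi] at ho
  apply Complex.ext
  · apply mul_left_cancel₀ hN
    linear_combination d.re * hdot - d.im * ho
  · apply mul_left_cancel₀ hN
    linear_combination d.im * hdot + d.re * ho

end Euc

/-! ## Delaunay triangulations of piecewise euclidean surfaces -/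

namespace Triangulation

variable {T : Type*} {Δ : Triangulation T} {ℓ : Δ.Edge → ℝ}

namespace EuclideanTriangle

open Euc

theorem dist_pt_add_two (σ : EuclideanTriangle ℓ) (i : Fin 3) :
    dist (σ.pt (i + 2)) (σ.pt i) = ℓ (Δ.edge σ.tri (i + 1)) := by
  rw [← σ.dist_eq, (fin_three_add i).1, (fin_three_add i).2.1]

theorem dist_pt_add_one (σ : EuclideanTriangle ℓ) (i : Fin 3) :
    dist (σ.pt i) (σ.pt (i + 1)) = ℓ (Δ.edge σ.tri (i + 2)) := by
  rw [← σ.dist_eq, (fin_three_add i).2.2.1, (fin_three_add i).2.2.2]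

theorem orient_cyclic (f : Fin 3 → ℂ) (j : Fin 3) :
    ((starRingEnd ℂ) (f 1 - f 0) * (f 2 - f 0)).im = orient (f (j + 1)) (f (j + 2)) (f j) := by
  fin_cases j <;> simp [orient] <;> ring

theorem orient_pos (σ : EuclideanTriangle ℓ) (i : Fin 3) :
    0 < orient (σ.pt (i + 1)) (σ.pt (i + 2)) (σ.pt i) := by
  rw [← orient_cyclic]
  exact σ.oriented

theorem exists_circumcircle (σ : EuclideanTriangle ℓ) :
    ∃ (c : ℂ) (r : ℝ), ∀ k, dist (σ.pt k) c = r := by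
  obtain ⟨c, r, h1, h2, h0⟩ := exists_circumcenter (σ.orient_pos 0).ne'
  refine ⟨c, r, fun k => ?_⟩
  rcases fin_three_cases 0 k with rfl | rfl | rfl <;> assumption

/-- The side `j` of `τ` is attached to the side `i` of `σ`. -/
def AdjAt (σ : EuclideanTriangle ℓ) (i : Fin 3) (τ : EuclideanTriangle ℓ) (j : Fin 3) : Prop :=
  Δ.glue (σ.tri, i) = (τ.tri, j) ∧
    τ.pt (j + 1) = σ.pt (i + 2) ∧ τ.pt (j + 2) = σ.pt (i + 1)

theorem ext_side {σ τ : EuclideanTriangle ℓ} (h : σ.tri = τ.tri) (i : Fin 3)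
    (h1 : σ.pt (i + 1) = τ.pt (i + 1)) (h2 : σ.pt (i + 2) = τ.pt (i + 2)) : σ = τ := by
  have h0 : σ.pt i = τ.pt i := by
    have p := σ.orient_pos i
    have p' := τ.orient_pos i
    rw [← h1, ← h2] at p'
    refine eq_of_dist_eq_of_orient_pos ?_ ?_ p p'
    · rw [dist_comm, σ.dist_pt_add_one, h1, dist_comm, τ.dist_pt_add_one, h]
    · rw [σ.dist_pt_add_two, h2, τ.dist_pt_add_two, h]
  obtain ⟨t, f, hf, hf'⟩ := σ
  obtain ⟨t', f', hf'', hf'''⟩ := τ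
  obtain rfl : t = t' := h
  obtain rfl : f = f' := by
    funext k
    rcases fin_three_cases i k with rfl | rfl | rfl <;> assumption
  rfl

theorem AdjAt.symm {σ τ : EuclideanTriangle ℓ} {i j : Fin 3} (h : σ.AdjAt i τ j) :
    τ.AdjAt j σ i := by
  refine ⟨?_, h.2.2.symm, h.2.1.symm⟩
  rw [← h.1, Δ.glue_glue]

theorem AdjAt.eq_of_adjAt {σ τ ρ : EuclideanTriangle ℓ} {i j k : Fin 3} (h : σ.AdjAt i τ j)
    (h' : τ.AdjAt j ρ k) : σ = ρ := by
  have h0 := h.symm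
  have hg := h0.1.symm.trans h'.1
  obtain rfl : i = k := congrArg Prod.snd hg
  refine ext_side (congrArg Prod.fst hg) i ?_ ?_
  · rw [h'.2.1, h0.2.1]
  · rw [h'.2.2, h0.2.2]

theorem exists_tri_pt_eq (hℓ : ∀ e, 0 < ℓ e) (hT : TriangleInequalities ℓ) (t : T) (j : Fin 3)
    {p q : ℂ} (h : dist p q = ℓ (Δ.edge t j)) :
    ∃ τ : EuclideanTriangle ℓ, τ.tri = t ∧ τ.pt (j + 1) = p ∧ τ.pt (j + 2) = q := by
  obtain ⟨n1, n2, n3⟩ := fin_three_add_ne j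
  obtain ⟨e1, e2, e3, e4⟩ := fin_three_add j
  have p0 := hℓ (Δ.edge t j)
  have p1 := hℓ (Δ.edge t (j + 1))
  have p2 := hℓ (Δ.edge t (j + 2))
  -- `z` is the apex over the base from `0` to `1` after scaling side `j` to length one, with the
  -- angle at `0` given by the law of cosines.
  obtain ⟨z, hz1, hz2, hz3⟩ : ∃ z : ℂ, ‖z‖ = ℓ (Δ.edge t (j + 2)) / ℓ (Δ.edge t j) ∧
      ‖z - 1‖ = ℓ (Δ.edge t (j + 1)) / ℓ (Δ.edge t j) ∧ 0 < z.im := by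
    have hC := hT.sq_cornerCos_lt_one hℓ (t, j + 1)
    obtain ⟨C, hCdef⟩ : ∃ C, C = cornerCos ℓ (t, j + 1) := ⟨_, rfl⟩
    rw [← hCdef] at hC
    unfold cornerCos at hCdef
    dsimp only at hCdef
    rw [e1, e2] at hCdef
    generalize ℓ (Δ.edge t j) = a at *
    generalize ℓ (Δ.edge t (j + 1)) = b at *
    generalize ℓ (Δ.edge t (j + 2)) = c at *
    have hS : 0 < 1 - C ^ 2 := by linarith
    have hS2 := Real.sq_sqrt hS.le
    refine ⟨⟨c / a * C, c / a * √(1 - C ^ 2)⟩, ?_, ?_, ?_⟩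
    · rw [← sq_eq_sq₀ (norm_nonneg _) (by positivity), ← Complex.normSq_eq_norm_sq,
        Complex.normSq_apply]
      dsimp only
      linear_combination (c / a) ^ 2 * hS2
    · rw [← sq_eq_sq₀ (norm_nonneg _) (by positivity), ← Complex.normSq_eq_norm_sq,
        Complex.normSq_apply, Complex.sub_re, Complex.sub_im, Complex.one_re, Complex.one_im]
      dsimp only
      have : (c / a * C - 1) * (c / a * C - 1) + (c / a * √(1 - C ^ 2) - 0) *
          (c / a * √(1 - C ^ 2) - 0) = (c / a) ^ 2 - 2 * (c / a) * C + 1 := by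
        linear_combination (c / a) ^ 2 * hS2
      rw [this, hCdef]
      field_simp
      ring
    · exact mul_pos (by positivity) (Real.sqrt_pos.2 hS)
  have hn : ‖q - p‖ = ℓ (Δ.edge t j) := by rw [← h, dist_comm, Complex.dist_eq]
  let f : Fin 3 → ℂ := fun k => if k = j then p + (q - p) * z else if k = j + 1 then p else q
  have f0 : f j = p + (q - p) * z := by simp [f]
  have f1 : f (j + 1) = p := by simp [f, n1]
  have f2 : f (j + 2) = q := by simp [f, n2, n3]
  refine ⟨⟨t, f, fun i => ?_, ?_⟩, rfl, f1, f2⟩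
  · rcases fin_three_cases j i with rfl | rfl | rfl
    · rw [f1, f2, h]
    · rw [e1, e2, f2, f0, dist_comm, Complex.dist_eq]
      have : p + (q - p) * z - q = (q - p) * (z - 1) := by ring
      rw [this, norm_mul, hn, hz2]
      field_simp
    · rw [e3, e4, f1, f0, Complex.dist_eq, add_sub_cancel_left, norm_mul, hn, hz1]
      field_simp
  · rw [orient_cyclic f j, f1, f2, f0]
    have : orient p q (p + (q - p) * z) = ‖q - p‖ ^ 2 * z.im := by
      rw [← Complex.normSq_eq_norm_sq, Complex.normSq_apply]
      simp [orient]
      ring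
    rw [this, hn]
    positivity

theorem exists_adjAt (hℓ : ∀ e, 0 < ℓ e) (hT : TriangleInequalities ℓ) (σ : EuclideanTriangle ℓ)
    (i : Fin 3) : ∃ τ, ∃ j, σ.AdjAt i τ j := by
  obtain ⟨⟨t, j⟩, hg⟩ : ∃ d, Δ.glue (σ.tri, i) = d := ⟨_, rfl⟩
  obtain ⟨τ, h0, h1, h2⟩ := exists_tri_pt_eq hℓ hT t j (p := σ.pt (i + 2)) (q := σ.pt (i + 1))
    (by rw [edge_eq_of_glue hg, ← σ.dist_eq, dist_comm])
  exact ⟨τ, j, by rw [hg, h0], h1, h2⟩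

/-- Sine and cosine of the angle opposite to the side `i`. -/
theorem exists_sin (hℓ : ∀ e, 0 < ℓ e) (σ : EuclideanTriangle ℓ) (i : Fin 3) :
    ∃ m S : ℝ, 0 < m ∧ 0 < S ∧ S ^ 2 + cornerCos ℓ (σ.tri, i) ^ 2 = 1 ∧
      orient (σ.pt (i + 1)) (σ.pt (i + 2)) (σ.pt i) = m * S ∧
      dot (σ.pt (i + 1)) (σ.pt (i + 2)) (σ.pt i) = m * cornerCos ℓ (σ.tri, i) := by
  have p1 := hℓ (Δ.edge σ.tri (i + 1))
  have p2 := hℓ (Δ.edge σ.tri (i + 2))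
  have ho := σ.orient_pos i
  set m := ℓ (Δ.edge σ.tri (i + 1)) * ℓ (Δ.edge σ.tri (i + 2)) with hm
  have hm0 : 0 < m := mul_pos p1 p2
  have d0 := dist_sq (σ.pt (i + 1)) (σ.pt (i + 2))
  have d1 := dist_sq (σ.pt (i + 2)) (σ.pt i)
  have d2 := dist_sq (σ.pt i) (σ.pt (i + 1))
  rw [σ.dist_eq] at d0
  rw [σ.dist_pt_add_two] at d1
  rw [σ.dist_pt_add_one] at d2
  have hdot : dot (σ.pt (i + 1)) (σ.pt (i + 2)) (σ.pt i) = m * cornerCos ℓ (σ.tri, i) := by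
    unfold cornerCos
    dsimp only
    rw [hm]
    field_simp
    rw [d0, d1, d2]
    unfold dot
    ring
  refine ⟨m, orient (σ.pt (i + 1)) (σ.pt (i + 2)) (σ.pt i) / m, hm0, by positivity, ?_,
    by field_simp, hdot⟩
  have hsum : orient (σ.pt (i + 1)) (σ.pt (i + 2)) (σ.pt i) ^ 2 +
      dot (σ.pt (i + 1)) (σ.pt (i + 2)) (σ.pt i) ^ 2 = m ^ 2 := by
    rw [hm, mul_pow, d1, d2]
    unfold orient dot
    ring
  rw [hdot] at hsum
  field_simp
  linarith

/-- The apex of the neighboring triangle is outside the circumcircle if and only if the opposite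
angles add up to at most `π`. -/
theorem AdjAt.power_nonneg_iff (hℓ : ∀ e, 0 < ℓ e) {σ τ : EuclideanTriangle ℓ} {i j : Fin 3}
    (h : σ.AdjAt i τ j) {c : ℂ} {r : ℝ} (hc : ∀ k, dist (σ.pt k) c = r) :
    0 ≤ power c r (τ.pt j) ↔ 0 ≤ cornerCos ℓ (σ.tri, i) + cornerCos ℓ (Δ.glue (σ.tri, i)) := by
  obtain ⟨m, S, hm, hS, hSC, ho, hd⟩ := σ.exists_sin hℓ i
  obtain ⟨m', S', hm', hS', hSC', ho', hd'⟩ := τ.exists_sin hℓ j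
  have hp := power_mul_orient (hc (i + 1)) (hc (i + 2)) (hc i) (τ.pt j)
  rw [h.2.1, h.2.2] at ho' hd'
  have hsymm : dot (σ.pt (i + 1)) (σ.pt (i + 2)) (τ.pt j) =
      dot (σ.pt (i + 2)) (σ.pt (i + 1)) (τ.pt j) := by unfold dot; ring
  rw [hsymm, ho, ho', hd, hd'] at hp
  rw [h.1, ← Euc.sin_add_nonneg_iff hS hS' hSC hSC']
  have hmS : 0 < m * S := mul_pos hm hS
  have hmm : 0 < m * m' := mul_pos hm hm'
  have hp' : power c r (τ.pt j) * (m * S) = (S * cornerCos ℓ (τ.tri, j) +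
      S' * cornerCos ℓ (σ.tri, i)) * (m * m') := by rw [hp]; ring
  rw [← mul_nonneg_iff_of_pos_right hmS, hp', mul_nonneg_iff_of_pos_right hmm]

end EuclideanTriangle

open EuclideanTriangle Euc

/-! ### The local condition and empty circumdisks -/

theorem IsEuclideanDelaunay.locallyDelaunay (hℓ : ∀ e, 0 < ℓ e) (hT : TriangleInequalities ℓ)
    (h : IsEuclideanDelaunay ℓ) : LocallyDelaunay ℓ := by
  rintro ⟨t, i⟩
  obtain ⟨σ, rfl, c, r, hc, hempty⟩ := h t
  obtain ⟨τ, j, hτ⟩ := σ.exists_adjAt hℓ hT i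
  have hr : 0 ≤ r := hc 0 ▸ dist_nonneg
  rw [← hτ.power_nonneg_iff hℓ hc]
  refine not_lt.1 fun hlt => hempty τ j (.single ⟨i, ?_, j, hτ⟩)
    ((mem_ball_iff_power_neg hr).2 hlt)
  -- The midpoint of a chord is inside the open disk, so unfolding across side `i` is allowed and
  -- reaches the neighbor's apex.
  refine ⟨midpoint ℝ (σ.pt (i + 1)) (σ.pt (i + 2)), midpoint_mem_segment _ _, ?_⟩
  rw [mem_ball_iff_power_neg hr]
  have h1 := power_eq_zero (hc (i + 1))
  have h2 := power_eq_zero (hc (i + 2))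
  have h3 := dist_sq (σ.pt (i + 1)) (σ.pt (i + 2))
  rw [σ.dist_eq] at h3
  have hp := pow_pos (hℓ (Δ.edge σ.tri i)) 2
  have hm : midpoint ℝ (σ.pt (i + 1)) (σ.pt (i + 2)) =
      ((1 / 2 : ℝ) : ℂ) * (σ.pt (i + 1) + σ.pt (i + 2)) := by
    rw [midpoint_eq_smul_add, Complex.real_smul]
    norm_num
  rw [hm]
  unfold power at *
  simp only [Complex.re_ofReal_mul, Complex.im_ofReal_mul, Complex.add_re, Complex.add_im]
  nlinarith

theorem UnfoldsOver.exists_reducedPath {c : ℂ} {r : ℝ} {σ τ : EuclideanTriangle ℓ}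
    (h : UnfoldsOver c r σ τ) :
    ∃ o, ReducedPath (fun a i b j =>
      (segment ℝ (a.pt (i + 1)) (a.pt (i + 2)) ∩ Metric.ball c r).Nonempty ∧ a.AdjAt i b j)
        σ τ o := by
  obtain ⟨τ', o, rfl, hr⟩ := ReducedPath.exists_of_reflTransGen
    (R := fun (a : EuclideanTriangle ℓ) i b j =>
      (segment ℝ (a.pt (i + 1)) (a.pt (i + 2)) ∩ Metric.ball c r).Nonempty ∧ a.AdjAt i b j)
    (E := Eq) eq_equivalence (by rintro x _ i y' j rfl hR; exact ⟨y', rfl, hR⟩)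
    (fun h1 h2 => h1.2.eq_of_adjAt h2.2)
    (Relation.ReflTransGen.mono (fun a b hab => by
      obtain ⟨i, hi, j, hj⟩ := hab
      exact ⟨i, j, hi, hj⟩) _ _ h)
  exact ⟨o, hr⟩

/-- Along a reduced path crossing a disk whose boundary circumscribes the first triangle, the
part of the disk lying ahead is contained in the circumdisk of the last triangle. -/
theorem LocallyDelaunay.mem_ball_of_reducedPath (hℓ : ∀ e, 0 < ℓ e) (hD : LocallyDelaunay ℓ)
    {c : ℂ} {r : ℝ} {σ τ : EuclideanTriangle ℓ} (hc : ∀ k, dist (σ.pt k) c = r)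
    {o : Option (Fin 3)}
    (h : ReducedPath (fun a i b j =>
      (segment ℝ (a.pt (i + 1)) (a.pt (i + 2)) ∩ Metric.ball c r).Nonempty ∧ a.AdjAt i b j)
        σ τ o) :
    (∀ k, τ.pt k ∉ Metric.ball c r) ∧
    (∀ j, o = some j → (segment ℝ (τ.pt (j + 1)) (τ.pt (j + 2)) ∩ Metric.ball c r).Nonempty) ∧
    ∃ c' r', (∀ k, dist (τ.pt k) c' = r') ∧ ∀ z ∈ Metric.ball c r,
      (∀ j, o = some j → 0 ≤ orient (τ.pt (j + 1)) (τ.pt (j + 2)) z) → z ∈ Metric.ball c' r' := by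
  induction h with
  | base =>
    refine ⟨fun k hk => ?_, fun j hj => by simp at hj, c, r, hc, fun z hz _ => hz⟩
    rw [Metric.mem_ball, hc k] at hk
    exact lt_irrefl _ hk
  | @step x o i y j _ ho hxy ih =>
    obtain ⟨hv, hs, c', r', hc', hin⟩ := ih
    obtain ⟨hseg, hadj⟩ := hxy
    obtain ⟨c'', r'', hc''⟩ := y.exists_circumcircle
    have hr' : 0 ≤ r' := hc' 0 ▸ dist_nonneg
    have hr'' : 0 ≤ r'' := hc'' 0 ▸ dist_nonneg
    have hahead : ∀ z ∈ Metric.ball c r, 0 ≤ orient (y.pt (j + 1)) (y.pt (j + 2)) z →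
        z ∈ Metric.ball c'' r'' := by
      intro z hz hzj
      have hzi : orient (x.pt (i + 1)) (x.pt (i + 2)) z ≤ 0 := by
        rw [hadj.2.1, hadj.2.2] at hzj
        have : orient (x.pt (i + 2)) (x.pt (i + 1)) z =
          -orient (x.pt (i + 1)) (x.pt (i + 2)) z := by unfold orient; ring
        linarith
      -- A point beyond the exit side and also behind the side of entry would lie in the sector
      -- opposite to `x` at their common vertex. The disk meets both sides but not that vertex, so
      -- this cannot happen.
      have hz' : z ∈ Metric.ball c' r' := by
        refine hin z hz fun k hk => ?_
        have hki : k ≠ i := fun hki => ho (hk.trans (congrArg some hki))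
        by_contra! hlt
        obtain ⟨u, hu, huB⟩ := hs k hk
        obtain ⟨w, hw, hwB⟩ := hseg
        obtain ⟨e1, e2, e3, e4⟩ := fin_three_add i
        rcases fin_three_cases i k with rfl | rfl | rfl
        · exact hki rfl
        · rw [e1, e2] at hlt hu
          have hpos := x.orient_pos (i + 2)
          rw [e3, e4] at hpos
          exact not_mem_ball_of_orient_nonpos hpos (hv _) hu huB hw hwB hzi hlt.le hz
        · rw [e3, e4] at hlt hu
          have hpos := x.orient_pos (i + 1)
          rw [e1, e2] at hpos
          exact not_mem_ball_of_orient_nonpos hpos (hv _) hw hwB hu huB hlt.le hzi hz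
      rw [mem_ball_iff_power_neg hr'] at hz'
      rw [mem_ball_iff_power_neg hr'']
      have hloc := (hadj.power_nonneg_iff hℓ hc').2 (hD (x.tri, i))
      have hpos := y.orient_pos j
      -- Beyond the common side the power with respect to the new circle is at most that with
      -- respect to the old one; the local condition at the apex of `y` fixes this sign.
      have hdiff := power_sub_power_mul_orient (c := c') (r := r') (a := y.pt (j + 1))
        (b := y.pt (j + 2))
        (by rw [hadj.2.1]; exact hc' _) (by rw [hadj.2.2]; exact hc' _) (hc'' _) (hc'' _)
        z (y.pt j)
      rw [power_eq_zero (hc'' j), sub_zero] at hdiff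
      have hnn : 0 ≤ (power c' r' z - power c'' r'' z) *
          orient (y.pt (j + 1)) (y.pt (j + 2)) (y.pt j) := by
        rw [hdiff]; exact mul_nonneg hloc hzj
      linarith [nonneg_of_mul_nonneg_left hnn hpos]
    refine ⟨fun k => ?_, ?_, c'', r'', hc'', fun z hz hzj => hahead z hz (hzj j rfl)⟩
    · rcases fin_three_cases j k with rfl | rfl | rfl
      -- The new apex lies ahead, so inside the original disk it would be in the open circumdisk of
      -- its own triangle.
      · intro hk
        have := hahead _ hk (y.orient_pos k).le
        rw [Metric.mem_ball, hc'' k] at this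
        exact lt_irrefl _ this
      · rw [hadj.2.1]; exact hv _
      · rw [hadj.2.2]; exact hv _
    · rintro _ ⟨⟩
      rw [hadj.2.1, hadj.2.2, segment_symm]
      exact hseg

theorem LocallyDelaunay.isEuclideanDelaunay (hℓ : ∀ e, 0 < ℓ e) (hT : TriangleInequalities ℓ)
    (hD : LocallyDelaunay ℓ) : IsEuclideanDelaunay ℓ := by
  intro t
  obtain ⟨σ, hσ, -⟩ := exists_tri_pt_eq hℓ hT t 0 (p := 0) (q := (ℓ (Δ.edge t 0) : ℂ)) (by
    rw [dist_comm, dist_zero_right, Complex.norm_real, Real.norm_of_nonneg (hℓ _).le])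
  obtain ⟨c, r, hc⟩ := σ.exists_circumcircle
  refine ⟨σ, hσ, c, r, hc, fun τ k hτ => ?_⟩
  obtain ⟨o, ho⟩ := hτ.exists_reducedPath
  exact (hD.mem_ball_of_reducedPath hℓ hc ho).1 k

end Triangulation

theorem mainTheorem11 {T : Type*} [Finite T] [Nonempty T] (Δ : Triangulation T)
    (lam : Δ.Edge → ℝ) :
    (Triangulation.IsIdealDelaunay lam →
      Triangulation.TriangleInequalities (Triangulation.ell lam) ∧
        Triangulation.IsEuclideanDelaunay (Triangulation.ell lam)) ∧
    (Triangulation.TriangleInequalities (Triangulation.ell lam) →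
      Triangulation.IsEuclideanDelaunay (Triangulation.ell lam) →
        Triangulation.IsIdealDelaunay lam) := by
  refine ⟨fun h => ?_, fun hT hE => ?_⟩
  · obtain ⟨hT, hD⟩ := h.locallyDelaunay
    exact ⟨hT, hD.isEuclideanDelaunay (Triangulation.ell_pos lam) hT⟩
  · exact (hE.locallyDelaunay (Triangulation.ell_pos lam) hT).isIdealDelaunay hT
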